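/- For $g\ge 2$ let $\Sigma_g$ be the closed orientable surface of genus $g$, i.e. (up to homeomorphism) the quotient of a closed $4g$-gon by the side pairing with boundary word $a_1b_1a_1^{-1}b_1^{-1}\cdots a_gb_ga_g^{-1}b_g^{-1}$, and let $\Gamma=\pi_1(\Sigma_g)$ be its fundamental group (at any base point). Let $\operatorname{Sym}(\mathbb Z)$ be the group of all permutations of $\mathbb Z$ with the topology of pointwise convergence, i.e. the subspace topology from $\mathbb Z^{\mathbb Z}$ with $\mathbb Z$ discrete. Then $\operatorname{Sym}(\mathbb Z)$ has a dense subgroup isomorphic to $\Gamma$. Equivalently, $\Gamma$ has a faithful, highly transitive action on a countably infinite set, where an action is highly transitive if for every $k\in\mathbb N$ it is transitive on ordered $k$-tuples of distinct elements. -/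

import Mathlib

/-- The topology of pointwise convergence on `Sym(ℤ)`: the restriction to the permutations of the
product topology on `ℤ → ℤ`, where `ℤ` is discrete. -/
instance permIntTopology : TopologicalSpace (Equiv.Perm ℤ) :=
  TopologicalSpace.induced (fun σ : Equiv.Perm ℤ => (σ : ℤ → ℤ)) inferInstance

/-- The closed unit disc, regarded as a polygon with `4 * g` sides. -/
abbrev PolygonDisc : Type := Metric.closedBall (0 : ℂ) 1

/-- The point `exp (2 π i s / (4 g))` of the boundary circle; the `k`-th side of the `4 * g`-gon
(`0 ≤ k < 4 * g`) is the arc of those with `k ≤ s ≤ k + 1`. -/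
noncomputable def boundaryPoint (g : ℕ) (s : ℝ) : PolygonDisc :=
  ⟨Complex.exp ((2 * Real.pi * s / (4 * g) : ℝ) * Complex.I), by
    rw [mem_closedBall_zero_iff, Complex.norm_exp_ofReal_mul_I]⟩

/-- The side pairing of the `4 * g`-gon with boundary word
`a₁ b₁ a₁⁻¹ b₁⁻¹ ⋯ a_g b_g a_g⁻¹ b_g⁻¹`. -/
inductive SidePairing (g : ℕ) : PolygonDisc → PolygonDisc → Prop
  | a (j : Fin g) (t : ℝ) (ht : t ∈ Set.Icc (0 : ℝ) 1) :
      SidePairing g (boundaryPoint g (4 * (j : ℕ) + t)) (boundaryPoint g (4 * (j : ℕ) + 3 - t))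
  | b (j : Fin g) (t : ℝ) (ht : t ∈ Set.Icc (0 : ℝ) 1) :
      SidePairing g (boundaryPoint g (4 * (j : ℕ) + 1 + t)) (boundaryPoint g (4 * (j : ℕ) + 4 - t))

/-- The closed orientable surface `Σ_g` of genus `g` (for `g ≥ 1`): the `4 * g`-gon modulo the
equivalence relation generated by the side pairing, with the quotient topology. -/
def ClosedSurface (g : ℕ) : Type := Quot (SidePairing g)

instance ClosedSurface.instTopologicalSpace (g : ℕ) : TopologicalSpace (ClosedSurface g) :=
  inferInstanceAs (TopologicalSpace (Quot (SidePairing g)))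

/-- An action is highly transitive if it is `k`-transitive, i.e. transitive on ordered `k`-tuples
of distinct elements, for every `k`. -/
def IsHighlyTransitive (G Y : Type*) [Group G] [MulAction G Y] : Prop :=
  ∀ k : ℕ, MulAction.IsMultiplyPretransitive G Y k

/-! Cutting the surface along a curve around the first handle presents `Γ` as an amalgam of two free
groups: `H` on the first handle and `K` on the others, glued along `c = d`, where `c` is the
commutator of the first handle and `d` the inverse of the product of the other handles. Let `H` act
freely with infinitely many orbits on `L`, and `K` likewise on `R`. Every bijection `t : L ≃ R` that
intertwines `c` and `d` lets both groups act on `L` compatibly, hence gives an action of `Γ`.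

A generic `t` works (`exists_generic_equiv`). It is the union of a chain of finite consistent sets
of pairs that meets countably many requirements: every point is covered, every reduced word outside
`H` moves some point, every injective tuple is carried to every other of the same length. A finite
set meets only finitely many orbits, so letters outside `⟨c⟩` and `⟨d⟩` always lead to new territory
(`exists_extend_moved`), and powers of a suitable `a` push any tuple into distinct unused
`⟨c⟩`-orbits (`exists_smul_unmet`). The property of `a` and `c` behind this, `PowerSeparated`, is
checked in a quotient of the free group. Uniqueness of normal forms is not needed: words outside `H`
move a point by construction, and `H` acts freely.

About the surface, only three facts enter: the side loops satisfy the relation (`handleProd_loops`),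
they generate (`closure_loops`), and permutations satisfying the relation extend to a homomorphism
(`monodromyHom_loopA`, `monodromyHom_loopB`). The first two come from loops `jump` that run through
the polygon and pass between identified points; the third is the monodromy of an explicit covering.

Density follows because a basic neighbourhood in `Sym(ℤ)` constrains only finitely many values. -/

/-! ### Generic equivariant bijections -/

section Generic

variable {H K L R : Type*} [Group H] [Group K] [MulAction H L] [MulAction K R]

/-- A finite set of pairs is consistent if it is contained in the graph of a bijection between
unions of `⟨c⟩`-orbits and `⟨d⟩`-orbits that intertwines `c` and `d`. -/
def Consistent (c : H) (d : K) (S : Finset (L × R)) : Prop :=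
  ∀ p ∈ S, ∀ q ∈ S, ∀ n : ℤ, q.1 = c ^ n • p.1 ↔ q.2 = d ^ n • p.2

/-- The `⟨c⟩`-orbit of `x` contains no point of `O`. -/
def Unmet (c : H) (O : Set L) (x : L) : Prop :=
  ∀ z ∈ O, ∀ n : ℤ, c ^ n • x ≠ z

/-- The `H`-orbit of `x` contains no point of `O`. -/
def Fresh (H : Type*) {L : Type*} [Group H] [MulAction H L] (O : Set L) (x : L) : Prop :=
  ∀ z ∈ O, ∀ h : H, h • x ≠ z

lemma Fresh.unmet {O : Set L} {x : L} (hx : Fresh H O x) (c : H) : Unmet c O x :=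
  fun z hz n => hx z hz (c ^ n)

lemma Fresh.mono {O O' : Set L} {x : L} (hx : Fresh H O x) (h : O' ⊆ O) : Fresh H O' x :=
  fun z hz => hx z (h hz)

lemma Unmet.mono {c : H} {O O' : Set L} {x : L} (hx : Unmet c O x) (h : O' ⊆ O) : Unmet c O' x :=
  fun z hz => hx z (h hz)

/-- A free action with infinitely many orbits. -/
structure AmpleFree (H L : Type*) [Group H] [MulAction H L] : Prop where
  free : ∀ (h : H) (x : L), h • x = x → h = 1
  exists_fresh : ∀ O : Set L, O.Finite → ∃ x, Fresh H O x

lemma AmpleFree.smul_left_injective (hL : AmpleFree H L) {h h' : H} {x : L}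
    (e : h • x = h' • x) : h = h' := by
  have := hL.free (h'⁻¹ * h) x (by rw [mul_smul, e, inv_smul_smul])
  exact (inv_mul_eq_one.1 this).symm

/-- Translates of `⟨c⟩` by powers of some element `a` meet `⟨c⟩` trivially. -/
def PowerSeparated (c a : H) : Prop :=
  ∀ i n m : ℤ, a ^ i * c ^ n * a ^ (-i) = c ^ m → i = 0 ∨ n = 0

lemma PowerSeparated.zpow_eq_one {c a : H} (h : PowerSeparated c a) {n : ℤ} (hn : c ^ n = 1) :
    n = 0 := by
  have := h 1 n 0 (by simp [hn])
  omega

/-- A power of `c` commutes with `c`, so conjugation by `a ^ i` would fix `c` itself. -/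
lemma PowerSeparated.eq_zero_of_zpow_eq {c a : H} (h : PowerSeparated c a) {i n : ℤ}
    (hn : a ^ i = c ^ n) : i = 0 := by
  have := h i 1 1 (by rw [hn, zpow_neg, hn, ← zpow_add, ← zpow_neg, ← zpow_add]; congr 1; ring)
  omega

lemma PowerSeparated.notMem {c a : H} (h : PowerSeparated c a) : a ∉ Subgroup.zpowers c := by
  rintro ⟨n, hn⟩
  have := h.eq_zero_of_zpow_eq (i := 1) (n := n) (by simpa using hn.symm)
  omega

/-- Any finite set of points can be moved to points in distinct `⟨c⟩`-orbits that avoid a given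
finite set. -/
lemma exists_smul_unmet (hL : AmpleFree H L) {c a : H} (hc : PowerSeparated c a)
    {ι : Type*} [Finite ι] (x : ι → L) (hx : Function.Injective x) (O : Set L) (hO : O.Finite) :
    ∃ f : H, (∀ i, Unmet c O (f • x i)) ∧
      ∀ i j, i ≠ j → ∀ n : ℤ, c ^ n • f • x i ≠ f • x j := by
  -- Two exponents that put `x i` into the `⟨c⟩`-orbit of `z` differ by one for which a power of `a`
  -- lies in `⟨c⟩`, so each pair `i`, `z` rules out at most one exponent.
  have h1 : ∀ (i : ι) (z : L), {N : ℤ | ∃ n : ℤ, c ^ n • a ^ N • x i = z}.Subsingleton := by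
    rintro i z N ⟨n, hn⟩ M ⟨m, hm⟩
    have := hL.smul_left_injective (h := c ^ n * a ^ N) (h' := c ^ m * a ^ M) (x := x i)
      (by rw [mul_smul, mul_smul, hn, hm])
    have h2 : a ^ (N - M) = c ^ (m - n) := by
      rw [sub_eq_neg_add m n, zpow_add, zpow_sub, mul_inv_eq_iff_eq_mul, mul_assoc, ← this,
        zpow_neg, inv_mul_cancel_left]
    have := hc.eq_zero_of_zpow_eq h2
    omega
  -- If `N` and `M` both fail, then `a ^ (M - N)` conjugates `c ^ n` to `c ^ m`; the alternative `n
  -- = 0` contradicts injectivity of `x`.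
  have h2 : ∀ i j : ι, i ≠ j →
      {N : ℤ | ∃ n : ℤ, c ^ n • a ^ N • x i = a ^ N • x j}.Subsingleton := by
    rintro i j hij N ⟨n, hn⟩ M ⟨m, hm⟩
    have e : (a ^ (-N) * c ^ n * a ^ N) = (a ^ (-M) * c ^ m * a ^ M) :=
      hL.smul_left_injective (x := x i) (by
        rw [mul_smul, mul_smul, mul_smul, mul_smul, hn, hm, zpow_neg, zpow_neg, inv_smul_smul,
          inv_smul_smul])
    have e2 : a ^ (M - N) * c ^ n * a ^ (-(M - N)) = c ^ m := by
      have : a ^ (M - N) * c ^ n * a ^ (-(M - N))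
          = a ^ M * (a ^ (-N) * c ^ n * a ^ N) * a ^ (-M) := by
        rw [show -(M - N) = N + -M by ring, zpow_add a N, sub_eq_add_neg, zpow_add]
        simp only [mul_assoc]
      rw [this, e]
      simp [mul_assoc]
    rcases hc _ _ _ e2 with h | rfl
    · omega
    · rw [zpow_zero, one_smul] at hn
      exact absurd (hx (smul_left_cancel _ hn)) hij
  have hfin : ((⋃ i : ι, ⋃ z ∈ O, {N : ℤ | ∃ n : ℤ, c ^ n • a ^ N • x i = z}) ∪
      ⋃ i : ι, ⋃ j ∈ {j | i ≠ j},
        {N : ℤ | ∃ n : ℤ, c ^ n • a ^ N • x i = a ^ N • x j}).Finite := by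
    refine Set.Finite.union (Set.finite_iUnion fun i => hO.biUnion fun z _ => (h1 i z).finite)
      (Set.finite_iUnion fun i => (Set.toFinite _).biUnion fun j hj => (h2 i j hj).finite)
  obtain ⟨N, hN⟩ := hfin.infinite_compl.nonempty
  simp only [Set.mem_compl_iff, Set.mem_union, Set.mem_iUnion, Set.mem_ofPred_eq, not_or,
    not_exists] at hN
  exact ⟨a ^ N, fun i z hz n hn => hN.1 i z hz n hn, fun i j hij n hn => hN.2 i j hij n hn⟩

variable {c a : H} {d b : K}

/-- The points of `L` occurring in `S`. -/
def domSet (S : Finset (L × R)) : Set L := Prod.fst '' (S : Set (L × R))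

/-- The points of `R` occurring in `S`. -/
def ranSet (S : Finset (L × R)) : Set R := Prod.snd '' (S : Set (L × R))

lemma finite_domSet (S : Finset (L × R)) : (domSet S).Finite := S.finite_toSet.image _

lemma finite_ranSet (S : Finset (L × R)) : (ranSet S).Finite := S.finite_toSet.image _

lemma domSet_insert [DecidableEq L] [DecidableEq R] (S : Finset (L × R)) (x : L) (y : R) :
    domSet (insert (x, y) S) = insert x (domSet S) := by
  simp [domSet, Set.image_insert_eq]

lemma ranSet_insert [DecidableEq L] [DecidableEq R] (S : Finset (L × R)) (x : L) (y : R) :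
    ranSet (insert (x, y) S) = insert y (ranSet S) := by
  simp [ranSet, Set.image_insert_eq]

/-- The new point lies in a new orbit on both sides, so every condition against an old pair is false
on both sides. Against itself, freeness and infinite order force the exponent `0`. -/
lemma Consistent.insert_unmet [DecidableEq L] [DecidableEq R] (hL : AmpleFree H L)
    (hR : AmpleFree K R) (hc : PowerSeparated c a) (hd : PowerSeparated d b) {S : Finset (L × R)}
    (hS : Consistent c d S) {x : L} {y : R} (hx : Unmet c (domSet S) x)
    (hy : Unmet d (ranSet S) y) :
    Consistent c d (insert (x, y) S) := by
  intro p hp q hq n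
  rw [Finset.mem_insert] at hp hq
  rcases hp with rfl | hp <;> rcases hq with rfl | hq
  · constructor <;> intro h
    · rw [hc.zpow_eq_one (hL.free _ _ h.symm)]; simp
    · rw [hd.zpow_eq_one (hR.free _ _ h.symm)]; simp
  · exact iff_of_false (fun h => hx q.1 ⟨q, hq, rfl⟩ n h.symm)
      (fun h => hy q.2 ⟨q, hq, rfl⟩ n h.symm)
  · refine iff_of_false (fun h => hx p.1 ⟨p, hp, rfl⟩ (-n) ?_)
      (fun h => hy p.2 ⟨p, hp, rfl⟩ (-n) ?_)
    · change x = _ at h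
      rw [h, zpow_neg, inv_smul_smul]
    · change y = _ at h
      rw [h, zpow_neg, inv_smul_smul]
  · exact hS p hp q hq n

/-- Equivariance forces this pair: the new condition is an old one with a shifted exponent. -/
lemma Consistent.insert_met [DecidableEq L] [DecidableEq R] {S : Finset (L × R)}
    (hS : Consistent c d S) {p : L × R} (hp : p ∈ S) (m : ℤ) :
    Consistent c d (insert (c ^ m • p.1, d ^ m • p.2) S) := by
  have key : ∀ q ∈ insert (c ^ m • p.1, d ^ m • p.2) S, ∃ q' ∈ S, ∃ k : ℤ,
      q.1 = c ^ k • q'.1 ∧ q.2 = d ^ k • q'.2 := by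
    intro q hq
    rcases Finset.mem_insert.1 hq with rfl | hq
    · exact ⟨p, hp, m, rfl, rfl⟩
    · exact ⟨q, hq, 0, by simp, by simp⟩
  intro q hq r hr n
  obtain ⟨q', hq', k, hk1, hk2⟩ := key q hq
  obtain ⟨r', hr', l, hl1, hl2⟩ := key r hr
  rw [hk1, hk2, hl1, hl2]
  have := hS q' hq' r' hr' (-l + (n + k))
  simpa only [zpow_add, mul_smul, zpow_neg, eq_inv_smul_iff] using this

/-- Every point of `L` can be added to the domain. -/
lemma exists_extend_dom (hL : AmpleFree H L) (hR : AmpleFree K R) (hc : PowerSeparated c a)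
    (hd : PowerSeparated d b) {S : Finset (L × R)} (hS : Consistent c d S) (x : L) :
    ∃ S', S ⊆ S' ∧ Consistent c d S' ∧ ∃ y, (x, y) ∈ S' := by
  classical
  by_cases h : Unmet c (domSet S) x
  · obtain ⟨y, hy⟩ := hR.exists_fresh _ (finite_ranSet S)
    exact ⟨_, Finset.subset_insert _ _, hS.insert_unmet hL hR hc hd h (hy.unmet d), y,
      Finset.mem_insert_self _ _⟩
  · simp only [Unmet, not_forall, not_not] at h
    obtain ⟨_, ⟨p, hp, rfl⟩, n, hn⟩ := h
    have := hS.insert_met hp (-n)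
    rw [← hn, zpow_neg, inv_smul_smul] at this
    exact ⟨_, Finset.subset_insert _ _, this, _, Finset.mem_insert_self _ _⟩

/-- Every point of `R` can be added to the range. -/
lemma exists_extend_ran (hL : AmpleFree H L) (hR : AmpleFree K R) (hc : PowerSeparated c a)
    (hd : PowerSeparated d b) {S : Finset (L × R)} (hS : Consistent c d S) (y : R) :
    ∃ S', S ⊆ S' ∧ Consistent c d S' ∧ ∃ x, (x, y) ∈ S' := by
  classical
  by_cases h : Unmet d (ranSet S) y
  · obtain ⟨x, hx⟩ := hL.exists_fresh _ (finite_domSet S)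
    exact ⟨_, Finset.subset_insert _ _, hS.insert_unmet hL hR hc hd (hx.unmet c) h, x,
      Finset.mem_insert_self _ _⟩
  · simp only [Unmet, not_forall, not_not] at h
    obtain ⟨_, ⟨p, hp, rfl⟩, n, hn⟩ := h
    have := hS.insert_met hp (-n)
    rw [← hn, zpow_neg d, inv_smul_smul] at this
    exact ⟨_, Finset.subset_insert _ _, this, _, Finset.mem_insert_self _ _⟩

/-- `Run S ps x x'`: the word `ps`, read from the head, leads from `x` to `x'` along pairs
of `S`. -/
def Run (S : Finset (L × R)) : List (H × K) → L → L → Prop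
  | [], x, x' => x = x'
  | p :: ps, x, x' => ∃ u y, (p.1 • x, u) ∈ S ∧ (y, p.2 • u) ∈ S ∧ Run S ps y x'

lemma Run.mono {S S' : Finset (L × R)} (h : S ⊆ S') {ps : List (H × K)} {x x' : L}
    (hr : Run S ps x x') : Run S' ps x x' := by
  induction ps generalizing x with
  | nil => exact hr
  | cons p ps ih =>
    obtain ⟨u, y, h1, h2, h3⟩ := hr
    exact ⟨u, y, h h1, h h2, ih h3⟩

/-- A word none of whose letters lies in the amalgamated subgroups. -/
def ReducedWord (c : H) (d : K) (ps : List (H × K)) : Prop :=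
  ∀ p ∈ ps, p.1 ∉ Subgroup.zpowers c ∧ p.2 ∉ Subgroup.zpowers d

/-- This is where reducedness enters: a letter outside `⟨c⟩` leaves the only `⟨c⟩`-orbit in the
`H`-orbit of `x` that can have been used. -/
lemma unmet_smul {O : Set L} {x : L} (hx : ∀ z ∈ O, ∀ h : H, h • x = z → h ∈ Subgroup.zpowers c)
    {l : H} (hl : l ∉ Subgroup.zpowers c) : Unmet c O (l • x) := by
  intro z hz n hn
  rw [← mul_smul] at hn
  exact hl ((Subgroup.mul_mem_cancel_left _ (Subgroup.zpow_mem_zpowers c n)).1 (hx z hz _ hn))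

/-- Two new pairs connecting `x` to a fresh point by means of a letter `r`. -/
lemma exists_extend_letter (hL : AmpleFree H L) (hR : AmpleFree K R) (hc : PowerSeparated c a)
    (hd : PowerSeparated d b) {S : Finset (L × R)} (hS : Consistent c d S) {x : L}
    (hx : Unmet c (domSet S) x) {r : K} (hr : r ∉ Subgroup.zpowers d) (O : Set L)
    (hO : O.Finite) :
    ∃ S', S ⊆ S' ∧ Consistent c d S' ∧ ∃ u y, (x, u) ∈ S' ∧ (y, r • u) ∈ S' ∧ Fresh H O y ∧
      ∀ z ∈ domSet S', ∀ h : H, h • y = z → h ∈ Subgroup.zpowers c := by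
  classical
  obtain ⟨u, hu⟩ := hR.exists_fresh _ (finite_ranSet S)
  have hS1 := hS.insert_unmet hL hR hc hd hx (hu.unmet d)
  obtain ⟨y, hy⟩ := hL.exists_fresh _ ((finite_domSet (insert (x, u) S)).union hO)
  have hru : Unmet d (ranSet (insert (x, u) S)) (r • u) := by
    refine unmet_smul ?_ hr
    rw [ranSet_insert]
    rintro z (rfl | hz) h hh
    · rw [hR.free _ _ hh]; exact one_mem _
    · exact absurd hh (hu z hz h)
  refine ⟨_, (Finset.subset_insert (x, u) S).trans (Finset.subset_insert (y, r • u) _),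
    hS1.insert_unmet hL hR hc hd ((hy.mono Set.subset_union_left).unmet c) hru, u, y,
    by simp, by simp, hy.mono Set.subset_union_right, ?_⟩
  rw [domSet_insert]
  rintro z (rfl | hz) h hh
  · rw [hL.free _ _ hh]; exact one_mem _
  · exact absurd hh (hy z (Or.inl hz) h)

/-- A reduced word can be made to lead to a point that avoids a given finite set. -/
lemma exists_extend_run (hL : AmpleFree H L) (hR : AmpleFree K R) (hc : PowerSeparated c a)
    (hd : PowerSeparated d b) {ps : List (H × K)} (hps : ReducedWord c d ps) (O : Set L)
    (hO : O.Finite) {S : Finset (L × R)} (hS : Consistent c d S) {x : L}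
    (hx : ∀ z ∈ domSet S, ∀ h : H, h • x = z → h ∈ Subgroup.zpowers c) :
    ∃ S', S ⊆ S' ∧ Consistent c d S' ∧ ∃ x', Run S' ps x x' ∧
      (Fresh H O x ∨ ps ≠ [] → Fresh H O x') := by
  induction ps generalizing S x with
  | nil => exact ⟨S, subset_rfl, hS, x, rfl, by simp⟩
  | cons p ps ih =>
    obtain ⟨h1, h2⟩ := hps p (by simp)
    obtain ⟨S1, hSS1, hS1, u, y, hxu, hyu, hyO, hy⟩ :=
      exists_extend_letter hL hR hc hd hS (unmet_smul hx h1) h2 O hO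
    obtain ⟨S2, hS12, hS2, x', hrun, hx'⟩ := ih (fun q hq => hps q (by simp [hq])) hS1 hy
    exact ⟨S2, hSS1.trans hS12, hS2, x', ⟨u, y, hS12 hxu, hS12 hyu, hrun⟩,
      fun _ => hx' (Or.inl hyO)⟩

/-- A nontrivial word can be made to move a point. -/
lemma exists_extend_moved (hL : AmpleFree H L) (hR : AmpleFree K R) (hc : PowerSeparated c a)
    (hd : PowerSeparated d b) (l : H) {ps : List (H × K)} (hps : ReducedWord c d ps) (r : K)
    (hne : ¬ (ps = [] ∧ r ∈ Subgroup.zpowers d)) {S : Finset (L × R)} (hS : Consistent c d S) :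
    ∃ S', S ⊆ S' ∧ Consistent c d S' ∧ ∃ x u y x', (x, u) ∈ S' ∧ (y, r • u) ∈ S' ∧
      Run S' ps y x' ∧ l • x' ≠ x := by
  classical
  obtain ⟨x, hx⟩ := hL.exists_fresh _ (finite_domSet S)
  by_cases hr : r ∈ Subgroup.zpowers d
  -- Here `d ^ n` acts on `x` as `c ^ n`, so the run has to start at `c ^ n • x`; its word is
  -- nonempty and takes it to an orbit other than that of `x`.
  · obtain ⟨n, rfl⟩ := hr
    obtain ⟨u, hu⟩ := hR.exists_fresh _ (finite_ranSet S)
    have hS1 := hS.insert_unmet hL hR hc hd (hx.unmet c) (hu.unmet d)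
    have hS2 := hS1.insert_met (p := (x, u)) (by simp) n
    obtain ⟨S3, hS23, hS3, x', hrun, hx'⟩ :=
      exists_extend_run hL hR hc hd hps {x} (Set.finite_singleton x) hS2 (x := c ^ n • x) (by
        rw [domSet_insert, domSet_insert]
        rintro z (rfl | rfl | hz) h hh
        · rw [hL.free _ _ hh]; exact one_mem _
        · rw [← mul_smul] at hh
          rw [eq_inv_of_mul_eq_one_left (hL.free _ _ hh), ← zpow_neg]
          exact Subgroup.zpow_mem_zpowers _ _
        · rw [← mul_smul] at hh
          exact absurd hh (hx z hz _))
    refine ⟨S3, fun p hp => hS23 (by simp [hp]), hS3, x, u, _, x', hS23 (by simp), hS23 (by simp),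
      hrun, hx' (Or.inr fun h => hne ⟨h, n, rfl⟩) x rfl l⟩
  · obtain ⟨S1, hSS1, hS1, u, y, hxu, hyu, hyO, hy⟩ :=
      exists_extend_letter hL hR hc hd hS (hx.unmet c) hr {x} (Set.finite_singleton x)
    obtain ⟨S2, hS12, hS2, x', hrun, hx'⟩ :=
      exists_extend_run hL hR hc hd hps {x} (Set.finite_singleton x) hS1 hy
    exact ⟨S2, hSS1.trans hS12, hS2, x, u, y, x', hS12 hxu, hS12 hyu, hrun,
      hx' (Or.inl hyO) x rfl l⟩

/-- A finite family of pairs of points in distinct new orbits can be connected by one letter. -/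
lemma exists_extend_family (hL : AmpleFree H L) (hR : AmpleFree K R) (hc : PowerSeparated c a)
    (hd : PowerSeparated d b) {r : K} (hr : r ∉ Subgroup.zpowers d) {ι : Type*}
    {S : Finset (L × R)} (hS : Consistent c d S) (z : ι ⊕ ι → L)
    (hz : ∀ i, Unmet c (domSet S) (z i)) (hz' : ∀ i j, i ≠ j → ∀ n : ℤ, c ^ n • z i ≠ z j)
    (s : Finset ι) :
    ∃ S', S ⊆ S' ∧ Consistent c d S' ∧
      (∀ i ∈ s, ∃ u, (z (.inl i), u) ∈ S' ∧ (z (.inr i), r • u) ∈ S') ∧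
      ∀ i ∉ s, Unmet c (domSet S') (z (.inl i)) ∧ Unmet c (domSet S') (z (.inr i)) := by
  classical
  induction s using Finset.induction_on with
  | empty => exact ⟨S, subset_rfl, hS, by simp, fun i _ => ⟨hz _, hz _⟩⟩
  | insert i s his ih =>
    obtain ⟨S1, hSS1, hS1, hin, hout⟩ := ih
    obtain ⟨u, hu⟩ := hR.exists_fresh _ (finite_ranSet S1)
    have hS2 := hS1.insert_unmet hL hR hc hd (hout i his).1 (hu.unmet d)
    have hru : Unmet d (ranSet (insert (z (.inl i), u) S1)) (r • u) := by
      refine unmet_smul ?_ hr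
      rw [ranSet_insert]
      rintro z (rfl | hz) h hh
      · rw [hR.free _ _ hh]; exact one_mem _
      · exact absurd hh (hu z hz h)
    have hun : Unmet c (domSet (insert (z (.inl i), u) S1)) (z (.inr i)) := by
      rw [domSet_insert]
      rintro w (rfl | hw) n
      · exact hz' _ _ (by simp) n
      · exact (hout i his).2 w hw n
    refine ⟨_, hSS1.trans ((Finset.subset_insert _ _).trans (Finset.subset_insert _ _)),
      hS2.insert_unmet hL hR hc hd hun hru, fun j hj => ?_, fun j hj => ?_⟩
    · rcases Finset.mem_insert.1 hj with rfl | hj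
      · exact ⟨u, by simp, by simp⟩
      · obtain ⟨v, h1, h2⟩ := hin j hj
        exact ⟨v, by simp [h1], by simp [h2]⟩
    · rw [Finset.mem_insert, not_or] at hj
      rw [domSet_insert, domSet_insert]
      constructor
      · rintro w (rfl | rfl | hw) n
        · exact hz' _ _ (by simp) n
        · exact hz' _ _ (by simp [hj.1]) n
        · exact (hout j hj.2).1 w hw n
      · rintro w (rfl | rfl | hw) n
        · exact hz' _ _ (by simp [hj.1]) n
        · exact hz' _ _ (by simp) n
        · exact (hout j hj.2).2 w hw n

/-- One injective tuple can be made to be carried to another one. -/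
lemma exists_extend_tuple (hL : AmpleFree H L) (hR : AmpleFree K R) (hc : PowerSeparated c a)
    (hd : PowerSeparated d b) {ι : Type*} [Finite ι] (x y : ι → L) (hx : Function.Injective x)
    (hy : Function.Injective y) {S : Finset (L × R)} (hS : Consistent c d S) :
    ∃ S', S ⊆ S' ∧ Consistent c d S' ∧ ∃ (f f' : H) (r : K), ∀ i, ∃ u,
      (f • x i, u) ∈ S' ∧ (f' • y i, r • u) ∈ S' := by
  obtain ⟨f, hf1, hf2⟩ := exists_smul_unmet hL hc x hx _ (finite_domSet S)
  -- The second tuple must also avoid the orbits just chosen for the first one.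
  obtain ⟨f', hf1', hf2'⟩ := exists_smul_unmet hL hc y hy
    (domSet S ∪ Set.range fun i => f • x i) ((finite_domSet S).union (Set.finite_range _))
  have := Fintype.ofFinite ι
  obtain ⟨S', h1, h2, h3, -⟩ := exists_extend_family hL hR hc hd hd.notMem hS
    (Sum.elim (fun i => f • x i) fun i => f' • y i)
    (by
      rintro (i | i)
      · exact hf1 i
      · exact (hf1' i).mono Set.subset_union_left)
    (by
      rintro (i | i) (j | j) hij n
      · exact hf2 i j (by simpa using hij) n
      · intro h
        refine hf1' j (f • x i) (Or.inr ⟨i, rfl⟩) (-n) ?_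
        simp only [Sum.elim_inl, Sum.elim_inr] at h
        rw [← h, zpow_neg, inv_smul_smul]
      · exact hf1' i (f • x j) (Or.inr ⟨j, rfl⟩) n
      · exact hf2' i j (by simpa using hij) n) Finset.univ
  exact ⟨S', h1, h2, f, f', b, fun i => h3 i (Finset.mem_univ i)⟩

/-- The action of a word on `L`, with `K` acting through `t`. -/
def wordSMul (t : L ≃ R) : List (H × K) → L → L
  | [], x => x
  | p :: ps, x => wordSMul t ps (t.symm (p.2 • t (p.1 • x)))

lemma Run.wordSMul_eq {t : L ≃ R} {S : Finset (L × R)} (hS : ∀ p ∈ S, t p.1 = p.2)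
    {ps : List (H × K)} {x x' : L} (h : Run S ps x x') : wordSMul t ps x = x' := by
  induction ps generalizing x with
  | nil => exact h
  | cons p ps ih =>
    obtain ⟨u, y, h1, h2, h3⟩ := h
    have e1 := hS _ h1
    have e2 := hS _ h2
    simp only at e1 e2
    rw [wordSMul, e1, ← e2, Equiv.symm_apply_apply, ih h3]

/-- There is an equivariant bijection for which the resulting action of the amalgam on `L` is
faithful on reduced words and highly transitive. -/
theorem exists_generic_equiv [Countable H] [Countable K] [Countable L] [Countable R]
    (hL : AmpleFree H L) (hR : AmpleFree K R) (hc : PowerSeparated c a)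
    (hd : PowerSeparated d b) :
    ∃ t : L ≃ R, (∀ x, t (c • x) = d • t x) ∧
      (∀ (l : H) (ps : List (H × K)) (r : K), ReducedWord c d ps →
        ¬ (ps = [] ∧ r ∈ Subgroup.zpowers d) →
        ∃ x, l • wordSMul t ps (t.symm (r • t x)) ≠ x) ∧
      ∀ (k : ℕ) (x y : Fin k → L), Function.Injective x → Function.Injective y →
        ∃ (f f' : H) (r : K), ∀ i, t.symm (r • t (f • x i)) = f' • y i := by
  classical
  -- Finite approximations to `t`, ordered by inclusion. The index type `I` lists the requirements;
  -- it is countable, and each requirement is cofinal, so one chain meets them all.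
  let P := {S : Finset (L × R) // Consistent c d S}
  let I := L ⊕ R ⊕ (H × List (H × K) × K) ⊕ (Σ k : ℕ, (Fin k → L) × (Fin k → L))
  let good : I → P → Prop := fun i S => match i with
    | .inl x => ∃ y, (x, y) ∈ S.1
    | .inr (.inl y) => ∃ x, (x, y) ∈ S.1
    | .inr (.inr (.inl (l, ps, r))) => ReducedWord c d ps →
        ¬ (ps = [] ∧ r ∈ Subgroup.zpowers d) →
        ∃ x u y x', (x, u) ∈ S.1 ∧ (y, r • u) ∈ S.1 ∧ Run S.1 ps y x' ∧ l • x' ≠ x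
    | .inr (.inr (.inr ⟨k, x, y⟩)) => Function.Injective x → Function.Injective y →
        ∃ (f f' : H) (r : K), ∀ i, ∃ u, (f • x i, u) ∈ S.1 ∧ (f' • y i, r • u) ∈ S.1
  have hgood : ∀ i, IsCofinal {S : P | good i S} := by
    rintro (x | y | ⟨l, ps, r⟩ | ⟨k, x, y⟩) ⟨S, hS⟩
    · obtain ⟨S', h1, h2, h3⟩ := exists_extend_dom hL hR hc hd hS x
      exact ⟨⟨S', h2⟩, h3, h1⟩
    · obtain ⟨S', h1, h2, h3⟩ := exists_extend_ran hL hR hc hd hS y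
      exact ⟨⟨S', h2⟩, h3, h1⟩
    · by_cases hw : ReducedWord c d ps ∧ ¬ (ps = [] ∧ r ∈ Subgroup.zpowers d)
      · obtain ⟨S', h1, h2, h3⟩ := exists_extend_moved hL hR hc hd l hw.1 r hw.2 hS
        exact ⟨⟨S', h2⟩, fun _ _ => h3, h1⟩
      · exact ⟨⟨S, hS⟩, fun h h' => absurd ⟨h, h'⟩ hw, le_rfl⟩
    · by_cases hw : Function.Injective x ∧ Function.Injective y
      · obtain ⟨S', h1, h2, h3⟩ := exists_extend_tuple hL hR hc hd x y hw.1 hw.2 hS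
        exact ⟨⟨S', h2⟩, fun _ _ => h3, h1⟩
      · exact ⟨⟨S, hS⟩, fun h h' => absurd ⟨h, h'⟩ hw, le_rfl⟩
  have : Encodable I := Encodable.ofCountable I
  let D : I → Order.Cofinal P := fun i => ⟨{S : P | good i S}, hgood i⟩
  let T : ℕ → P := Order.sequenceOfCofinals ⟨∅, by simp [Consistent]⟩ D
  have hmono : Monotone T := Order.sequenceOfCofinals.monotone _ _
  have hT : ∀ i, ∃ n, good i (T n) := fun i => 
    ⟨_, Order.sequenceOfCofinals.encode_mem _ D i⟩
  -- Any two pairs occur together at some stage. Exponent `0` makes the union the graph of a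
  -- bijection, exponent `1` makes it equivariant.
  have hcons : ∀ {p q : L × R} {n m : ℕ}, p ∈ (T n).1 → q ∈ (T m).1 → ∀ k : ℤ,
      q.1 = c ^ k • p.1 ↔ q.2 = d ^ k • p.2 := fun {p q n m} hp hq k =>
    (T (max n m)).2 p (hmono (le_max_left n m) hp) q (hmono (le_max_right n m) hq) k
  have hdom : ∀ x, ∃ y, ∃ n, (x, y) ∈ (T n).1 := fun x => by
    obtain ⟨n, y, h⟩ := hT (.inl x); exact ⟨y, n, h⟩
  have hran : ∀ y, ∃ x, ∃ n, (x, y) ∈ (T n).1 := fun y => by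
    obtain ⟨n, x, h⟩ := hT (.inr (.inl y)); exact ⟨x, n, h⟩
  choose t ht using hdom
  choose s hs using hran
  have huniq : ∀ {x : L} {y : R} {n : ℕ}, (x, y) ∈ (T n).1 → t x = y := fun {x y n} h => by
    obtain ⟨m, hm⟩ := ht x
    simpa using hcons h hm 0
  have huniq' : ∀ {x : L} {y : R} {n : ℕ}, (x, y) ∈ (T n).1 → s y = x := fun {x y n} h => by
    obtain ⟨m, hm⟩ := hs y
    simpa using hcons h hm 0
  let e : L ≃ R := ⟨t, s, fun x => huniq' (ht x).choose_spec, fun y => huniq (hs y).choose_spec⟩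
  have he : ∀ n, ∀ p ∈ (T n).1, e p.1 = p.2 := fun n p hp => huniq hp
  refine ⟨e, fun x => ?_, fun l ps r hps hne => ?_, fun k x y hx hy => ?_⟩
  · obtain ⟨n, hn⟩ := ht x
    obtain ⟨m, hm⟩ := ht (c • x)
    have := hcons hn hm 1
    rwa [zpow_one, zpow_one, eq_self_iff_true, true_iff] at this
  · obtain ⟨n, hn⟩ := hT (.inr (.inr (.inl (l, ps, r))))
    obtain ⟨x, u, y, x', h1, h2, h3, h4⟩ := hn hps hne
    refine ⟨x, ?_⟩
    have e1 := he n _ h1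
    have e2 := he n _ h2
    simp only at e1 e2
    rwa [e1, ← e2, Equiv.symm_apply_apply, h3.wordSMul_eq (he n)]
  · obtain ⟨n, hn⟩ := hT (.inr (.inr (.inr ⟨k, x, y⟩)))
    obtain ⟨f, f', r, h⟩ := hn hx hy
    refine ⟨f, f', r, fun i => ?_⟩
    obtain ⟨u, h1, h2⟩ := h i
    have e1 := he n _ h1
    have e2 := he n _ h2
    simp only at e1 e2
    rw [e1, ← e2, Equiv.symm_apply_apply]

end Generic

/-! ### Highly transitive actions of amalgams -/

section Amalgam

variable {H K Γ : Type*} [Group H] [Group K] [Group Γ]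

/-- The value of a word in a group; the head of the list is the rightmost factor. -/
def wordProd (φ : H →* Γ) (ψ : K →* Γ) : List (H × K) → Γ
  | [] => 1
  | p :: ps => wordProd φ ψ ps * (ψ p.2 * φ p.1)

/-- In a group generated by the images of `H` and `K`, with `c` and `d` identified, every element
is represented by a reduced word. -/
lemma exists_reducedWord {c : H} {d : K} (φ : H →* Γ) (ψ : K →* Γ) (hcd : φ c = ψ d)
    (hgen : Subgroup.closure (Set.range φ ∪ Set.range ψ) = ⊤) (γ : Γ) :
    ∃ (l : H) (ps : List (H × K)) (r : K), ReducedWord c d ps ∧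
      γ = φ l * wordProd φ ψ ps * ψ r := by
  have hcd' : ∀ n : ℤ, φ (c ^ n) = ψ (d ^ n) := fun n => by rw [map_zpow, map_zpow, hcd]
  have hψ : ∀ (x : Γ) (k : K), (∃ (l : H) (ps : List (H × K)) (r : K), ReducedWord c d ps ∧
      x = φ l * wordProd φ ψ ps * ψ r) → ∃ (l : H) (ps : List (H × K)) (r : K),
      ReducedWord c d ps ∧ x * ψ k = φ l * wordProd φ ψ ps * ψ r := by
    rintro x k ⟨l, ps, r, hps, rfl⟩
    exact ⟨l, ps, r * k, hps, by rw [map_mul, mul_assoc]⟩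
  -- If `r` is a power of `d`, it passes through the amalgamation into `H` and merges with `h` and
  -- the head letter; should the result land in `⟨c⟩`, it passes back into `K` and the word gets
  -- shorter. Otherwise `h` is absorbed into `r`, or `(h, r)` becomes the new head.
  have hφ : ∀ (x : Γ) (h : H), (∃ (l : H) (ps : List (H × K)) (r : K), ReducedWord c d ps ∧
      x = φ l * wordProd φ ψ ps * ψ r) → ∃ (l : H) (ps : List (H × K)) (r : K),
      ReducedWord c d ps ∧ x * φ h = φ l * wordProd φ ψ ps * ψ r := by
    rintro x h ⟨l, ps, r, hps, rfl⟩
    by_cases hr : r ∈ Subgroup.zpowers d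
    · obtain ⟨n, rfl⟩ := hr
      rw [← hcd', mul_assoc, ← map_mul]
      generalize c ^ n * h = h'
      cases ps with
      | nil => exact ⟨l * h', [], 1, hps, by simp [wordProd]⟩
      | cons p ps =>
        have hps' : ReducedWord c d ps := fun q hq => hps q (by simp [hq])
        by_cases hl : p.1 * h' ∈ Subgroup.zpowers c
        · obtain ⟨m, hm⟩ := Subgroup.mem_zpowers_iff.1 hl
          refine ⟨l, ps, p.2 * d ^ m, hps', ?_⟩
          rw [wordProd, map_mul ψ, ← hcd', hm, map_mul]
          simp only [mul_assoc]
        · refine ⟨l, (p.1 * h', p.2) :: ps, 1, ?_, ?_⟩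
          · intro q hq
            rcases List.mem_cons.1 hq with rfl | hq
            · exact ⟨hl, (hps p (by simp)).2⟩
            · exact hps' q hq
          · simp only [wordProd, map_mul, mul_assoc, map_one, mul_one]
    · by_cases hh : h ∈ Subgroup.zpowers c
      · obtain ⟨n, rfl⟩ := hh
        refine ⟨l, ps, r * d ^ n, hps, ?_⟩
        simp only [hcd', map_mul, mul_assoc]
      · refine ⟨l, (h, r) :: ps, 1, ?_, ?_⟩
        · intro q hq
          rcases List.mem_cons.1 hq with rfl | hq
          · exact ⟨hh, hr⟩
          · exact hps q hq
        · simp only [wordProd, mul_assoc, map_one, mul_one]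
  have hγ : γ ∈ Subgroup.closure (Set.range φ ∪ Set.range ψ) := hgen ▸ Subgroup.mem_top γ
  induction hγ using Subgroup.closure_induction_right with
  | one => exact ⟨1, [], 1, by simp [ReducedWord], by simp [wordProd]⟩
  | mul_right x _ y hy ih =>
    rcases hy with ⟨h, rfl⟩ | ⟨k, rfl⟩
    · exact hφ x h ih
    · exact hψ x k ih
  | mul_inv_cancel x _ y hy ih =>
    rcases hy with ⟨h, rfl⟩ | ⟨k, rfl⟩
    · rw [← map_inv]; exact hφ x _ ih
    · rw [← map_inv]; exact hψ x _ ih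

/-- The left translation action on countably many copies of a group. -/
@[reducible] def leftTranslation (H : Type*) [Group H] : MulAction H (H × ℕ) where
  smul h x := (h * x.1, x.2)
  one_smul x := Prod.ext (one_mul x.1) rfl
  mul_smul h h' x := Prod.ext (mul_assoc h h' x.1) rfl

/-- The `ℕ`-coordinate is invariant, so a copy not met by `O` supplies the fresh point. -/
lemma ampleFree_leftTranslation (H : Type*) [Group H] :
    letI := leftTranslation H; AmpleFree H (H × ℕ) := by
  let := leftTranslation H
  refine ⟨fun h x hx => mul_eq_right.1 (congrArg Prod.fst hx), fun O hO => ?_⟩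
  obtain ⟨n, hn⟩ := (hO.image Prod.snd).infinite_compl.nonempty
  exact ⟨(1, n), fun z hz h e => hn ⟨z, hz, congrArg Prod.snd e.symm⟩⟩

/-- A group with the universal property of the amalgam of `H` and `K` along `c = d` acts
faithfully and highly transitively on a countable set. -/
theorem exists_faithful_highlyTransitive_hom {H K : Type} [Group H] [Group K] [Countable H]
    [Countable K] {c a : H} {d b : K} (hc : PowerSeparated c a) (hd : PowerSeparated d b)
    (φ : H →* Γ) (ψ : K →* Γ) (hcd : φ c = ψ d)
    (hgen : Subgroup.closure (Set.range φ ∪ Set.range ψ) = ⊤)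
    (hext : ∀ (Y : Type) (ρ : H →* Equiv.Perm Y) (σ : K →* Equiv.Perm Y), ρ c = σ d →
      ∃ θ : Γ →* Equiv.Perm Y, (∀ h, θ (φ h) = ρ h) ∧ ∀ k, θ (ψ k) = σ k) :
    ∃ θ : Γ →* Equiv.Perm (H × ℕ), Function.Injective θ ∧
      ∀ (k : ℕ) (x y : Fin k → H × ℕ), Function.Injective x → Function.Injective y →
        ∃ γ, ∀ i, θ γ (x i) = y i := by
  let := leftTranslation H
  let := leftTranslation K
  have hL := ampleFree_leftTranslation H
  have hR := ampleFree_leftTranslation K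
  obtain ⟨t, ht, hfaith, htrans⟩ := exists_generic_equiv hL hR hc hd
  let ρ : H →* Equiv.Perm (H × ℕ) := MulAction.toPermHom H (H × ℕ)
  let σ : K →* Equiv.Perm (H × ℕ) :=
    (t.symm.permCongrHom : Equiv.Perm (K × ℕ) →* Equiv.Perm (H × ℕ)).comp
      (MulAction.toPermHom K (K × ℕ))
  have hσ : ∀ k x, σ k x = t.symm (k • t x) := fun k x => rfl
  have hρσ : ρ c = σ d := by
    ext1 x
    rw [hσ, ← ht, Equiv.symm_apply_apply]
    rfl
  obtain ⟨θ, hθφ, hθψ⟩ := hext _ ρ σ hρσ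
  have hθφ' : ∀ h x, θ (φ h) x = h • x := fun h x => by rw [hθφ]; rfl
  have hθψ' : ∀ k x, θ (ψ k) x = t.symm (k • t x) := fun k x => by rw [hθψ, hσ]
  have hword : ∀ (ps : List (H × K)) (x : H × ℕ), θ (wordProd φ ψ ps) x = wordSMul t ps x := by
    intro ps
    induction ps with
    | nil => intro x; simp [wordProd, wordSMul]
    | cons p ps ih =>
      intro x
      rw [wordProd, map_mul, map_mul, Equiv.Perm.mul_apply, Equiv.Perm.mul_apply, ih, hθφ', hθψ',
        wordSMul]
  refine ⟨θ, (injective_iff_map_eq_one θ).2 fun γ hγ => ?_, fun k x y hx hy => ?_⟩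
  · obtain ⟨l, ps, r, hps, rfl⟩ := exists_reducedWord φ ψ hcd hgen γ
    by_cases hne : ps = [] ∧ r ∈ Subgroup.zpowers d
    -- Only elements of the image of `H` remain, and `H` acts freely.
    · obtain ⟨rfl, n, rfl⟩ := hne
      have e : φ l * wordProd φ ψ [] * ψ (d ^ n) = φ (l * c ^ n) := by
        simp only [wordProd, map_mul, map_zpow, hcd, mul_one]
      change θ (φ l * wordProd φ ψ [] * ψ (d ^ n)) = 1 at hγ
      change φ l * wordProd φ ψ [] * ψ (d ^ n) = 1
      rw [e] at hγ ⊢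
      have := hL.free (l * c ^ n) (1, 0) (by rw [← hθφ', hγ]; rfl)
      rw [this, map_one]
    · obtain ⟨x, hx⟩ := hfaith l ps r hps hne
      refine absurd ?_ hx
      have := congrArg (fun f : Equiv.Perm (H × ℕ) => f x) hγ
      simpa [hθφ', hθψ', hword] using this
  · obtain ⟨f, f', r, h⟩ := htrans k x y hx hy
    refine ⟨φ f'⁻¹ * ψ r * φ f, fun i => ?_⟩
    rw [map_mul, map_mul, Equiv.Perm.mul_apply, Equiv.Perm.mul_apply, hθφ', hθφ', hθψ', h,
      inv_smul_smul]

end Amalgam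

/-! ### The surface relation -/

section SurfaceRelation

variable {G N : Type*} [Group G] [Group N]

/-- The commutator `β α⁻¹ β⁻¹ α`. -/
def handle (α β : G) : G := β * α⁻¹ * β⁻¹ * α

/-- The product `handle (A (n - 1)) (B (n - 1)) ⋯ handle (A 0) (B 0)`. -/
def handleProd (A B : ℕ → G) : ℕ → G
  | 0 => 1
  | n + 1 => handle (A n) (B n) * handleProd A B n

lemma map_handle (f : G →* N) (α β : G) : f (handle α β) = handle (f α) (f β) := by
  simp [handle]

lemma map_handleProd (f : G →* N) (A B : ℕ → G) (n : ℕ) :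
    f (handleProd A B n) = handleProd (fun i => f (A i)) (fun i => f (B i)) n := by
  induction n with
  | zero => simp [handleProd]
  | succ n ih => simp [handleProd, ih, map_handle]

/-- Peels off the first handle, the one that becomes the factor `H` of the amalgam. -/
lemma handleProd_succ' (A B : ℕ → G) (n : ℕ) :
    handleProd A B (n + 1) =
      handleProd (fun i => A (i + 1)) (fun i => B (i + 1)) n * handle (A 0) (B 0) := by
  induction n with
  | zero => simp [handleProd]
  | succ n ih => rw [handleProd, ih, handleProd, mul_assoc]

lemma handleProd_congr {A B A' B' : ℕ → G} {n : ℕ} (hA : ∀ i < n, A i = A' i)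
    (hB : ∀ i < n, B i = B' i) : handleProd A B n = handleProd A' B' n := by
  induction n with
  | zero => rfl
  | succ n ih =>
    rw [handleProd, handleProd, hA n (by omega), hB n (by omega),
      ih (fun i hi => hA i (by omega)) fun i hi => hB i (by omega)]

lemma PowerSeparated.of_map {c a : G} (f : G →* N) (h : PowerSeparated (f c) (f a)) :
    PowerSeparated c a := fun i n m e =>
  h i n m (by simpa only [map_mul, map_zpow] using congrArg f e)

lemma PowerSeparated.inv {c a : G} (h : PowerSeparated c a) : PowerSeparated c⁻¹ a := by
  intro i n m e
  have := h i (-n) (-m) (by simpa only [inv_zpow'] using e)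
  omega

/-- The shift on integer sequences. -/
def shiftPerm : Equiv.Perm (ℤ → ℤ) := Equiv.arrowCongr (Equiv.addRight 1) (Equiv.refl ℤ)

/-- Adding one at the origin. -/
def lampPerm : Equiv.Perm (ℤ → ℤ) := Equiv.addRight (Pi.single 0 1)

lemma shiftPerm_zpow_apply (i : ℤ) (f : ℤ → ℤ) (x : ℤ) : (shiftPerm ^ i) f x = f (x - i) := by
  induction i using Int.induction_on generalizing f x with
  | zero => simp
  | succ i ih =>
    rw [zpow_add_one, Equiv.Perm.mul_apply, ih]
    simp [shiftPerm, Equiv.arrowCongr, sub_eq_add_neg]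
    congr 1; ring
  | pred i ih =>
    rw [zpow_sub_one, Equiv.Perm.mul_apply, ih]
    change f _ = _
    simp
    congr 1; ring

lemma addRight_zpow_apply {M : Type*} [AddGroup M] (v : M) (n : ℤ) (f : M) :
    (Equiv.addRight v ^ n) f = f + n • v := by
  induction n using Int.induction_on generalizing f with
  | zero => simp
  | succ i ih =>
    rw [zpow_add_one, Equiv.Perm.mul_apply, ih, Equiv.coe_addRight, add_comm (i : ℤ) 1, add_zsmul,
      one_zsmul, add_assoc]
  | pred i ih =>
    rw [zpow_sub_one, Equiv.Perm.mul_apply, ih, sub_eq_neg_add, add_zsmul, neg_one_zsmul,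
      ← add_assoc]
    rfl

lemma handle_shiftPerm_lampPerm :
    handle shiftPerm lampPerm = Equiv.addRight (Pi.single 0 1 - Pi.single (-1) 1) := by
  ext f x
  have h1 := shiftPerm_zpow_apply 1
  have h2 := shiftPerm_zpow_apply (-1)
  have h3 : (Equiv.addRight (Pi.single 0 1 : ℤ → ℤ))⁻¹ = Equiv.addRight (-Pi.single 0 1) :=
    inv_eq_of_mul_eq_one_right (by ext; simp)
  simp only [zpow_one, zpow_neg] at h1 h2
  simp only [handle, Equiv.Perm.mul_apply, lampPerm, h3, Equiv.coe_addRight,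
    Pi.add_apply, h1, h2, Pi.neg_apply, Pi.sub_apply, Pi.single_apply]
  have : x - -1 = 0 ↔ x = -1 := by omega
  simp only [this]
  have h4 : x - -1 - 1 = x := by ring
  rw [h4]
  ring

/-- The commutator is translation by `v = δ₀ - δ₋₁`, and the shift moves its support. If `n` times
the translate of `v` by `i` equals `m • v`, then `i = 0` or `n = 0`. -/
lemma powerSeparated_shiftPerm :
    PowerSeparated (handle shiftPerm lampPerm) shiftPerm := by
  rw [handle_shiftPerm_lampPerm]
  intro i n m h
  by_contra! hin
  have key : ∀ x : ℤ, n * ((Pi.single 0 1 - Pi.single (-1) 1 : ℤ → ℤ) (x - i)) =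
      m * (Pi.single 0 1 - Pi.single (-1) 1 : ℤ → ℤ) x := by
    intro x
    have := congrArg (fun σ : Equiv.Perm (ℤ → ℤ) => σ 0 x) h
    simpa only [Equiv.Perm.mul_apply, shiftPerm_zpow_apply, addRight_zpow_apply,
      Equiv.coe_addRight, Pi.add_apply, Pi.zero_apply, zero_add, Pi.smul_apply, smul_eq_mul]
      using this
  have h1 := key i
  have h2 := key (i - 1)
  simp only [Pi.sub_apply, Pi.single_apply] at h1 h2
  have e1 : i - 1 - i = -1 := by ring
  rw [sub_self] at h1
  rw [e1] at h2
  have e2 : i - 1 = -1 ↔ i = 0 := by omega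
  simp only [if_neg hin.1, e2] at h1 h2
  -- For `i ≠ 0` the translate is supported at `i` and `i - 1`. The point `i` lies outside the
  -- support of `v` unless `i = -1`, and then `i - 1 = -2` does.
  by_cases h3 : i = -1
  · subst h3; norm_num at h2; exact hin.2 h2
  · simp only [if_neg h3] at h1; norm_num at h1; exact hin.2 h1

end SurfaceRelation

/-! ### The surface group as an amalgam of two free groups -/

section SurfacePresentation

/-- The generators of a free group on `n` handles, extended by `1`. -/
def handleGen (n : ℕ) (e : Bool) (i : ℕ) : FreeGroup (Fin n × Bool) :=
  if h : i < n then FreeGroup.of (⟨i, h⟩, e) else 1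

lemma lift_handleGen {G : Type*} [Group G] (n : ℕ) (A : Bool → ℕ → G) (e : Bool) {i : ℕ}
    (hi : i < n) :
    FreeGroup.lift (fun p : Fin n × Bool => A p.2 p.1) (handleGen n e i) = A e i := by
  simp [handleGen, hi]

/-- The property pulls back along homomorphisms, so the first handle can be sent to the shift and
the lamp and all others to `1`. -/
lemma powerSeparated_handleProd (n : ℕ) :
    PowerSeparated (handleProd (handleGen (n + 1) false) (handleGen (n + 1) true) (n + 1))
      (handleGen (n + 1) false 0) := by
  let A : Bool → ℕ → Equiv.Perm (ℤ → ℤ) := fun e i =>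
    if i = 0 then (if e then lampPerm else shiftPerm) else 1
  let f := FreeGroup.lift fun p : Fin (n + 1) × Bool => A p.2 p.1
  have h1 : ∀ m, handleProd (A false) (A true) (m + 1) = handle shiftPerm lampPerm := by
    intro m
    induction m with
    | zero => simp [handleProd, A]
    | succ m ih => rw [handleProd, ih]; simp [handle, A]
  refine PowerSeparated.of_map f ?_
  have h2 : f (handleProd (handleGen (n + 1) false) (handleGen (n + 1) true) (n + 1)) =
      handle shiftPerm lampPerm := by
    rw [map_handleProd, ← h1 n]
    exact handleProd_congr (fun i hi => lift_handleGen _ A false hi)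
      fun i hi => lift_handleGen _ A true hi
  have h3 : f (handleGen (n + 1) false 0) = shiftPerm := lift_handleGen _ A false (by omega)
  rw [h2, h3]
  exact powerSeparated_shiftPerm

/-- A group with the universal property of the surface group of genus `n + 2` acts faithfully and
highly transitively on a countably infinite set. -/
theorem exists_faithful_highlyTransitive_surface (n : ℕ) {Γ : Type*} [Group Γ] (A B : ℕ → Γ)
    (hrel : handleProd A B (n + 2) = 1)
    (hgen : Subgroup.closure (A '' Set.Iio (n + 2) ∪ B '' Set.Iio (n + 2)) = ⊤)
    (hext : ∀ (Y : Type) (A' B' : ℕ → Equiv.Perm Y), handleProd A' B' (n + 2) = 1 →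
      ∃ θ : Γ →* Equiv.Perm Y, ∀ i < n + 2, θ (A i) = A' i ∧ θ (B i) = B' i) :
    ∃ (Y : Type) (_ : Countable Y) (_ : Infinite Y) (θ : Γ →* Equiv.Perm Y),
      Function.Injective θ ∧ ∀ (k : ℕ) (x y : Fin k → Y), Function.Injective x →
        Function.Injective y → ∃ γ, ∀ i, θ γ (x i) = y i := by
  let C : Bool → ℕ → Γ := fun e => if e then B else A
  let φ : FreeGroup (Fin 1 × Bool) →* Γ := FreeGroup.lift fun p => C p.2 p.1
  let ψ : FreeGroup (Fin (n + 1) × Bool) →* Γ := FreeGroup.lift fun p => C p.2 (p.1 + 1)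
  have hφ : ∀ e, φ (handleGen 1 e 0) = C e 0 := fun e => lift_handleGen _ C e (by omega)
  have hψ : ∀ e, ∀ i < n + 1, ψ (handleGen (n + 1) e i) = C e (i + 1) :=
    fun e i hi => lift_handleGen _ (fun e i => C e (i + 1)) e hi
  let c := handleProd (handleGen 1 false) (handleGen 1 true) 1
  -- The relation says that the product of the remaining handles times the first is trivial, hence
  -- the inverse. There are `n + 1 ≥ 1` remaining handles; this is where genus at least two is
  -- needed.
  let d := (handleProd (handleGen (n + 1) false) (handleGen (n + 1) true) (n + 1))⁻¹
  have hc : c = handle (handleGen 1 false 0) (handleGen 1 true 0) := by simp [c, handleProd]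
  have hcd : φ c = ψ d := by
    rw [hc, map_handle, hφ, hφ, map_inv, map_handleProd, handleProd_congr (hψ false) (hψ true)]
    rw [handleProd_succ'] at hrel
    exact eq_inv_of_mul_eq_one_right hrel
  refine ⟨_, inferInstance, inferInstance, exists_faithful_highlyTransitive_hom
    (powerSeparated_handleProd 0)
    (powerSeparated_handleProd n).inv φ ψ hcd ?_ ?_⟩
  · rw [eq_top_iff, ← hgen, Subgroup.closure_le]
    have key : ∀ e, C e '' Set.Iio (n + 2) ⊆
        Subgroup.closure (Set.range φ ∪ Set.range ψ) := by
      rintro e _ ⟨i, hi, rfl⟩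
      apply Subgroup.subset_closure
      cases i with
      | zero => exact Or.inl ⟨_, hφ e⟩
      | succ i => exact Or.inr ⟨_, hψ e i (by simpa using hi)⟩
    exact Set.union_subset (key false) (key true)
  · intro Y ρ σ hρσ
    let D : Bool → ℕ → Equiv.Perm Y := fun e i => match i with
      | 0 => ρ (handleGen 1 e 0)
      | i + 1 => σ (handleGen (n + 1) e i)
    obtain ⟨θ, hθ⟩ := hext Y (D false) (D true) (by
      rw [handleProd_succ']
      change handleProd (fun i => σ _) (fun i => σ _) _ * handle (ρ _) (ρ _) = 1
      rw [← map_handleProd, ← map_handle, ← hc]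
      change ρ c = σ d at hρσ
      rw [hρσ, ← map_mul, mul_inv_cancel, map_one])
    have hθ' : ∀ e, ∀ i < n + 2, θ (C e i) = D e i := by
      rintro (_ | _) i hi
      exacts [(hθ i hi).1, (hθ i hi).2]
    have h1 : θ.comp φ = ρ := by
      ext1 ⟨i, e⟩
      obtain rfl : i = 0 := Subsingleton.elim _ _
      have := hθ' e 0 (by omega)
      rw [← hφ] at this
      simpa [handleGen, D] using this
    have h2 : θ.comp ψ = σ := by
      ext1 ⟨i, e⟩
      have := hθ' e (i + 1) (by omega)
      rw [← hψ e i i.2] at this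
      have hg : handleGen (n + 1) e i = FreeGroup.of (i, e) := dif_pos i.2
      simp only [D, hg] at this
      exact this
    exact ⟨θ, fun h => by rw [← h1]; rfl, fun k => by rw [← h2]; rfl⟩

end SurfacePresentation

/-! ### High transitivity and density -/

section Density

/-- A subgroup of `Sym(ℤ)` that carries any injective tuple to any other one is dense. -/
lemma dense_of_highlyTransitive (G : Subgroup (Equiv.Perm ℤ))
    (hG : ∀ (k : ℕ) (x y : Fin k → ℤ), Function.Injective x → Function.Injective y →
      ∃ γ ∈ G, ∀ i, γ (x i) = y i) : Dense (G : Set (Equiv.Perm ℤ)) := by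
  intro σ
  rw [mem_closure_iff_nhds]
  intro t ht
  rw [nhds_induced] at ht
  obtain ⟨u, hu, hut⟩ := ht
  -- The neighbourhood restricts only the values on a finite set `I`; enumerating `I` gives the
  -- tuple to be carried to its image under `σ`.
  rw [nhds_pi, Filter.mem_pi] at hu
  obtain ⟨I, hI, s, hs, hsu⟩ := hu
  obtain ⟨k, f, hf⟩ : ∃ (k : ℕ) (f : Fin k ≃ I), True := by
    have := hI.fintype
    exact ⟨_, (Fintype.equivFin I).symm, trivial⟩
  obtain ⟨γ, hγ, h⟩ := hG k (fun i => f i) (fun i => σ (f i))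
    (Subtype.val_injective.comp f.injective)
    (σ.injective.comp (Subtype.val_injective.comp f.injective))
  refine ⟨γ, hut (hsu fun i hi => ?_), hγ⟩
  have := h (f.symm ⟨i, hi⟩)
  simp only [Equiv.apply_symm_apply] at this
  change γ i ∈ s i
  rw [this]
  exact mem_of_mem_nhds (hs i)

/-- The passage from a faithful highly transitive permutation representation on a countably
infinite set to a dense subgroup of `Sym(ℤ)` and to a faithful highly transitive action. -/
theorem dense_subgroup_and_action_of_hom {Γ : Type*} [Group Γ] {Y : Type} [Countable Y]
    [Infinite Y] (θ : Γ →* Equiv.Perm Y) (hθ : Function.Injective θ)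
    (htrans : ∀ (k : ℕ) (x y : Fin k → Y), Function.Injective x →
        Function.Injective y → ∃ γ, ∀ i, θ γ (x i) = y i) :
    (∃ G : Subgroup (Equiv.Perm ℤ),
      Dense (G : Set (Equiv.Perm ℤ)) ∧ Nonempty (G ≃* Γ)) ∧
    (∃ (Y : Type) (_ : Countable Y) (_ : Infinite Y) (_ : MulAction Γ Y),
      FaithfulSMul Γ Y ∧ IsHighlyTransitive Γ Y) := by
  constructor
  · obtain ⟨e⟩ : Nonempty (Y ≃ ℤ) := nonempty_equiv_of_countable
    let τ : Γ →* Equiv.Perm ℤ := (e.permCongrHom : Equiv.Perm Y →* Equiv.Perm ℤ).comp θ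
    have hτ : Function.Injective τ := e.permCongrHom.injective.comp hθ
    refine ⟨τ.range, dense_of_highlyTransitive _ fun k x y hx hy => ?_,
      ⟨(MonoidHom.ofInjective hτ).symm⟩⟩
    obtain ⟨γ, hγ⟩ := htrans k (fun i => e.symm (x i)) (fun i => e.symm (y i))
      (e.symm.injective.comp hx) (e.symm.injective.comp hy)
    refine ⟨τ γ, ⟨γ, rfl⟩, fun i => ?_⟩
    change e (θ γ (e.symm (x i))) = y i
    rw [hγ, Equiv.apply_symm_apply]
  · let act : MulAction Γ Y := MulAction.compHom Y θ
    refine ⟨Y, inferInstance, inferInstance, act, ⟨fun {γ γ'} h => hθ (Equiv.ext h)⟩, fun k => ?_⟩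
    refine ⟨fun x y => ?_⟩
    obtain ⟨γ, hγ⟩ := htrans k x y x.injective y.injective
    exact ⟨γ, DFunLike.ext _ _ hγ⟩

end Density

/-! ### Generators of the fundamental group of a quotient of a simply connected space -/

section QuotientSpace

open Topology unitInterval

variable {D Q : Type*} [TopologicalSpace D] [SimplyConnectedSpace D] [TopologicalSpace Q]

instance unitInterval.instContractibleSpace : ContractibleSpace I :=
  (convex_Icc (0 : ℝ) 1).contractibleSpace ⟨0, by simp⟩

lemma Path.Homotopic.Quotient.map_trans {X Y : Type*} [TopologicalSpace X] [TopologicalSpace Y]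
    {x y z : X} (γ : Path.Homotopic.Quotient x y) (γ' : Path.Homotopic.Quotient y z)
    (f : C(X, Y)) : (γ.trans γ').map f = (γ.map f).trans (γ'.map f) := by
  induction γ using Path.Homotopic.Quotient.ind with | mk γ =>
  induction γ' using Path.Homotopic.Quotient.ind with | mk γ' =>
  exact congrArg Path.Homotopic.Quotient.mk (Path.map_trans γ γ' f.continuous)

lemma Path.Homotopic.Quotient.symm_of_trans {X : Type*} [TopologicalSpace X] {x y z : X}
    (γ : Path.Homotopic.Quotient x y) (γ' : Path.Homotopic.Quotient y z) :
    (γ.trans γ').symm = γ'.symm.trans γ.symm := by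
  induction γ using Path.Homotopic.Quotient.ind with | mk γ =>
  induction γ' using Path.Homotopic.Quotient.ind with | mk γ' =>
  exact congrArg Path.Homotopic.Quotient.mk (Path.trans_symm γ γ')

lemma Path.Homotopic.Quotient.symm_trans_trans {X : Type*} [TopologicalSpace X] {x y z : X}
    (γ : Path.Homotopic.Quotient x y) (γ' : Path.Homotopic.Quotient y z) :
    γ.symm.trans (γ.trans γ') = γ' := by
  rw [← trans_assoc, symm_trans, refl_trans]

lemma Path.Homotopic.Quotient.trans_symm_trans {X : Type*} [TopologicalSpace X] {x y z : X}
    (γ : Path.Homotopic.Quotient x y) (γ' : Path.Homotopic.Quotient x z) :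
    γ.trans (γ.symm.trans γ') = γ' := by
  rw [← trans_assoc, trans_symm, refl_trans]

/-- The class of the image of a path from `z₀` to `z`. -/
noncomputable def spoke (p : C(D, Q)) (z₀ z : D) {x : Q} (h : p z = x) :
    Path.Homotopic.Quotient (p z₀) x :=
  ((Path.Homotopic.Quotient.mk (PathConnectedSpace.somePath z₀ z)).map p).cast rfl h.symm

/-- Since `D` is simply connected, the path to `z` followed by `f` is homotopic to the chosen path
to `w`. -/
lemma spoke_trans (p : C(D, Q)) (z₀ : D) {z w : D} (f : Path z w) {x y : Q} (hx : p z = x)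
    (hy : p w = y) (q : Path x y) (hq : ∀ t, q t = p (f t)) :
    (spoke p z₀ z hx).trans (.mk q) = spoke p z₀ w hy := by
  subst hx hy
  obtain rfl : q = f.map p.continuous := Path.ext (funext hq)
  have : Path.Homotopic.Quotient.mk ((PathConnectedSpace.somePath z₀ z).trans f) =
      .mk (PathConnectedSpace.somePath z₀ w) := Subsingleton.elim _ _
  have := congrArg (fun γ => Path.Homotopic.Quotient.map γ p) this
  simp only [← Path.Homotopic.Quotient.mk_map, Path.map_trans] at this
  exact this

/-- The loop at `p z₀` that runs to `p z = p w` on the image of a path from `z₀` to `z` and back on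
the image of a path from `w` to `z₀`. -/
noncomputable def jump (p : C(D, Q)) (z₀ z w : D) (h : p z = p w) : FundamentalGroup Q (p z₀) :=
  .fromPath ((spoke p z₀ z h).trans (spoke p z₀ w rfl).symm)

lemma jump_eq (p : C(D, Q)) (z₀ : D) {z w : D} {x : Q} (hz : p z = x) (hw : p w = x) :
    (spoke p z₀ z hz).trans (spoke p z₀ w hw).symm = jump p z₀ z w (hz.trans hw.symm) := by
  subst hw; rfl

lemma jump_self (p : C(D, Q)) (z₀ z : D) : jump p z₀ z z rfl = 1 :=
  Path.Homotopic.Quotient.trans_symm _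

/-- Products compose from right to left: the right factor is traversed first, and the two spokes at
`w` cancel. -/
lemma jump_mul (p : C(D, Q)) (z₀ : D) {z w v : D} (h : p z = p w) (h' : p w = p v) :
    jump p z₀ w v h' * jump p z₀ z w h = jump p z₀ z v (h.trans h') := by
  rw [← jump_eq p z₀ (h.trans h') h', FundamentalGroup.mul_def]
  simp only [jump, Path.Homotopic.Quotient.trans_assoc,
    Path.Homotopic.Quotient.symm_trans_trans]

lemma jump_inv (p : C(D, Q)) (z₀ : D) {z w : D} (h : p z = p w) :
    (jump p z₀ z w h)⁻¹ = jump p z₀ w z h.symm :=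
  inv_eq_of_mul_eq_one_right (by rw [jump_mul, jump_self])

/-- Both spokes are prolonged by lifts of the same path in `Q`, which cancels. -/
lemma jump_congr_of_paths (p : C(D, Q)) (z₀ : D) {z w z' w' : D} (f : Path z w) (f' : Path z' w')
    (h : ∀ t, p (f t) = p (f' t)) (hz : p z = p z') (hw : p w = p w') :
    jump p z₀ z z' hz = jump p z₀ w w' hw := by
  let q : Path (p z') (p w') := f'.map p.continuous
  rw [jump, jump, ← spoke_trans p z₀ f hz hw q (fun t => (h t).symm),
    ← spoke_trans p z₀ f' rfl rfl q fun t => rfl]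
  simp only [Path.Homotopic.Quotient.symm_of_trans, Path.Homotopic.Quotient.trans_assoc,
    Path.Homotopic.Quotient.trans_symm_trans]

/-- The classes of the sides of a square. -/
lemma mk_trans_mk_of_square {a b c d : Q} (F : C(I × I, Q)) (f : Path a b) (g : Path c d)
    (l : Path a c) (r : Path b d) (hf : ∀ t, F (t, 0) = f t) (hg : ∀ t, F (t, 1) = g t)
    (hl : ∀ t, F (0, t) = l t) (hr : ∀ t, F (1, t) = r t) :
    (Path.Homotopic.Quotient.mk f).trans (.mk r) =
      (Path.Homotopic.Quotient.mk l).trans (.mk g) := by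
  obtain rfl : F (0, 0) = a := by rw [hf, f.source]
  obtain rfl : F (1, 0) = b := by rw [hf, f.target]
  obtain rfl : F (0, 1) = c := by rw [hg, g.source]
  obtain rfl : F (1, 1) = d := by rw [hg, g.target]
  let e : Path (0 : I) 1 := ⟨⟨id, continuous_id⟩, rfl, rfl⟩
  let f' : Path ((0, 0) : I × I) (1, 0) := e.prod (Path.refl 0)
  let g' : Path ((0, 1) : I × I) (1, 1) := e.prod (Path.refl 1)
  let l' : Path ((0, 0) : I × I) (0, 1) := (Path.refl 0).prod e
  let r' : Path ((1, 0) : I × I) (1, 1) := (Path.refl 1).prod e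
  obtain rfl : f = f'.map F.continuous := Path.ext (funext fun t => (hf t).symm)
  obtain rfl : g = g'.map F.continuous := Path.ext (funext fun t => (hg t).symm)
  obtain rfl : l = l'.map F.continuous := Path.ext (funext fun t => (hl t).symm)
  obtain rfl : r = r'.map F.continuous := Path.ext (funext fun t => (hr t).symm)
  simp only [Path.Homotopic.Quotient.mk_map, ← Path.Homotopic.Quotient.map_trans]
  exact congrArg (fun γ => Path.Homotopic.Quotient.map γ F) (Subsingleton.elim _ _)

/-- A contraction of the components of `U`, along paths that lift to `D`. -/
structure IsContraction (p : C(D, Q)) (U : Set Q) (k : D → C(I, D)) : Prop where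
  isOpen : IsOpen U
  continuousOn : ContinuousOn k (p ⁻¹' U)
  start : ∀ z, p z ∈ U → k z 0 = z
  compat : ∀ z w, p z = p w → p z ∈ U → ∀ t, p (k z t) = p (k w t)
  eventually_eq : ∀ z, p z ∈ U → ∀ᶠ w in 𝓝 z, p (k w 1) = p (k z 1)

/-- The contraction sweeps `q` over a square whose far side is constant. The two sides starting at
the ends of `q` lift to `D` and are absorbed by the spokes. -/
lemma IsContraction.exists_eq_jump {p : C(D, Q)} (hp : IsQuotientMap p) (z₀ : D) {U : Set Q}
    {k : D → C(I, D)} (hk : IsContraction p U k) {x y : Q} (q : Path x y) (hq : ∀ t, q t ∈ U)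
    {z w : D} (hz : p z = x) (hw : p w = y) :
    ∃ z' w', ∃ h : p z' = p w', (spoke p z₀ z hz).trans ((Path.Homotopic.Quotient.mk q).trans
      (spoke p z₀ w hw).symm) = jump p z₀ z' w' h := by
  subst hz hw
  let m : Q → C(I, Q) := fun x => p.comp (k (hp.surjective x).choose)
  have hm : ∀ v, p v ∈ U → m (p v) = p.comp (k v) := fun v hv => by
    have e := (hp.surjective (p v)).choose_spec
    exact ContinuousMap.ext fun t => hk.compat _ _ e (by rwa [e]) t
  -- Currying is essential: as a map into `C(I, Q)`, `m` can be tested for continuity on the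
  -- quotient map `p` itself, without its product with the interval.
  have hmU : ContinuousOn m U := by
    rw [hp.continuousOn_isOpen_iff hk.isOpen]
    refine ContinuousOn.congr (f := fun v => p.comp (k v)) ?_ fun v hv => hm v hv
    exact (ContinuousMap.continuous_postcomp p).comp_continuousOn hk.continuousOn
  have hmq : Continuous fun t => m (q t) := hmU.comp_continuous q.continuous hq
  let F : C(I × I, Q) := ⟨fun s => m (q s.1) s.2, ContinuousMap.continuous_uncurry_of_continuous
    ⟨_, hmq⟩⟩
  have hF0 : ∀ t, F (t, 0) = q t := fun t => by
    obtain ⟨v, hv⟩ := hp.surjective (q t)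
    have hv' : p v ∈ U := hv ▸ hq t
    change m (q t) 0 = q t
    rw [← hv, hm v hv', ContinuousMap.comp_apply, hk.start v hv']
  have hz : p z ∈ U := by simpa using hq 0
  have hw : p w ∈ U := by simpa using hq 1
  -- The end point of the contraction is locally constant along `q`, and the interval is connected.
  have hF1 : ∀ t, F (t, 1) = p (k z 1) := by
    have hloc : IsLocallyConstant fun t => m (q t) 1 := by
      rw [IsLocallyConstant.iff_eventually_eq]
      intro t
      have hopen : IsOpen {x | x ∈ U ∧ m x 1 = m (q t) 1} := by
        rw [← hp.isOpen_preimage, isOpen_iff_mem_nhds]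
        rintro v ⟨hv, hv'⟩
        filter_upwards [hk.eventually_eq v hv, (hk.isOpen.preimage p.continuous).mem_nhds hv]
          with u hu1 hu2
        refine ⟨hu2, ?_⟩
        rw [← hv', hm u hu2, hm v hv, ContinuousMap.comp_apply, ContinuousMap.comp_apply, hu1]
      filter_upwards [q.continuous.continuousAt.preimage_mem_nhds
        (hopen.mem_nhds ⟨hq t, rfl⟩)] with u hu using hu.2
    intro t
    have := hloc.apply_eq_of_preconnectedSpace t 0
    change m (q t) 1 = _
    rw [this, q.source, hm z hz, ContinuousMap.comp_apply]
  have hl : ∀ t, F (0, t) = p (k z t) := fun t => by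
    change m (q 0) t = _
    rw [q.source, hm z hz, ContinuousMap.comp_apply]
  have hr : ∀ t, F (1, t) = p (k w t) := fun t => by
    change m (q 1) t = _
    rw [q.target, hm w hw, ContinuousMap.comp_apply]
  have hzw : p (k z 1) = p (k w 1) := by rw [← hF1 1, hr]
  let lz : Path z (k z 1) := ⟨k z, hk.start z hz, rfl⟩
  let lw : Path w (k w 1) := ⟨k w, hk.start w hw, rfl⟩
  have sq := mk_trans_mk_of_square F q ((Path.refl (p (k z 1))).cast rfl hzw.symm)
    (lz.map p.continuous) (lw.map p.continuous) hF0 hF1 hl hr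
  refine ⟨k z 1, k w 1, hzw, ?_⟩
  have hlw := spoke_trans p z₀ lw rfl rfl (lw.map p.continuous) fun t => rfl
  have hlz := spoke_trans p z₀ lz rfl rfl (lz.map p.continuous) fun t => rfl
  have hconst := spoke_trans p z₀ (Path.refl (k z 1)) rfl hzw
    ((Path.refl (p (k z 1))).cast rfl hzw.symm) fun t => rfl
  rw [jump, ← hconst, ← hlw, ← hlz]
  simp only [Path.Homotopic.Quotient.symm_of_trans, Path.Homotopic.Quotient.trans_assoc]
  rw [← Path.Homotopic.Quotient.trans_assoc (.mk (lz.map p.continuous)), ← sq]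
  simp only [Path.Homotopic.Quotient.trans_assoc, Path.Homotopic.Quotient.trans_symm_trans]

/-- The loops `jump p z₀ z w` generate the fundamental group. -/
theorem eq_top_of_jump_mem {p : C(D, Q)} (hp : IsQuotientMap p) (z₀ : D) {ι : Type*}
    {U : ι → Set Q} {k : ι → D → C(I, D)} (hk : ∀ i, IsContraction p (U i) (k i))
    (hU : ⋃ i, U i = Set.univ) (P : Subgroup (FundamentalGroup Q (p z₀)))
    (hP : ∀ z w h, jump p z₀ z w h ∈ P) : P = ⊤ := by
  -- Pieces of `f` are images of paths `g` in the interval. As the interval is simply connected,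
  -- only the ends of `g` matter, which makes the pieces easy to splice.
  have key : ∀ (f : C(I, Q)) (z w : D) (hz : p z = f 0) (hw : p w = f 1) (g : Path (0 : I) 1),
      FundamentalGroup.fromPath ((spoke p z₀ z hz).trans
        (((Path.Homotopic.Quotient.mk g).map f).trans (spoke p z₀ w hw).symm)) ∈ P := by
    intro f z w hz hw g
    obtain ⟨t, ht0, htm, ⟨N, hN⟩, ht⟩ := exists_monotone_Icc_subset_open_cover_unitInterval
      (c := fun i => f ⁻¹' U i) (fun i => (hk i).isOpen.preimage f.continuous)
      (by rw [← Set.preimage_iUnion, hU, Set.preimage_univ])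
    have claim : ∀ (n : ℕ) (w : D) (hw : p w = f (t n)) (g : Path (0 : I) (t n)),
        FundamentalGroup.fromPath ((spoke p z₀ z hz).trans
          (((Path.Homotopic.Quotient.mk g).map f).trans (spoke p z₀ w hw).symm)) ∈ P := by
      intro n
      induction n with
      | zero =>
        generalize t 0 = s at ht0
        subst ht0
        intro w hw g
        have e : (Path.Homotopic.Quotient.mk g).map f = .refl (f 0) :=
          congrArg (fun γ => Path.Homotopic.Quotient.map γ f)
            (Subsingleton.elim (Path.Homotopic.Quotient.mk g) (.refl 0))
        rw [e, Path.Homotopic.Quotient.refl_trans, jump_eq]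
        exact hP _ _ _
      | succ n ih =>
        intro w hw g
        obtain ⟨v, hv⟩ := hp.surjective (f (t n))
        obtain ⟨i, hi⟩ := ht n
        let h : Path (t n) (t (n + 1)) :=
          { toFun := fun s => ⟨(1 - s) * t n + s * t (n + 1), by
              have := s.2.1; have := s.2.2; have := (t n).2.1; have := (t (n + 1)).2.1
              have := (t n).2.2; have := (t (n + 1)).2.2
              constructor <;> nlinarith⟩
            continuous_toFun := by fun_prop
            source' := by simp
            target' := by simp }
        have hh : ∀ s, h s ∈ Set.Icc (t n) (t (n + 1)) := by
          intro s
          have h1 : (t n : ℝ) ≤ t (n + 1) := htm n.le_succ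
          have := s.2.1; have := s.2.2
          refine ⟨?_, ?_⟩ <;> rw [← Subtype.coe_le_coe] <;>
            change _ ≤ (_ : ℝ) <;> simp only [h, Path.coe_mk_mk] <;> nlinarith
        let g₀ : Path (0 : I) (t n) := PathConnectedSpace.somePath 0 (t n)
        have e : Path.Homotopic.Quotient.mk g = (Path.Homotopic.Quotient.mk g₀).trans (.mk h) :=
          Subsingleton.elim _ _
        obtain ⟨z', w', h', hj⟩ := (hk i).exists_eq_jump hp z₀ (h.map f.continuous)
          (fun s => hi (hh s)) hv hw
        -- The loop is cut at `f (t n)` by a detour to the centre point through a preimage `v`; the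
        -- last piece lies in one `U i`.
        have h2 := mul_mem (hj ▸ hP z' w' h') (ih v hv g₀)
        rw [e, Path.Homotopic.Quotient.map_trans]
        convert h2 using 1
        rw [FundamentalGroup.mul_def]
        simp only [Path.Homotopic.Quotient.trans_assoc, Path.Homotopic.Quotient.symm_trans_trans]
        rfl
    have last : ∀ s : I, s = 1 → (∀ (w : D) (hw : p w = f s) (g : Path (0 : I) s),
        FundamentalGroup.fromPath ((spoke p z₀ z hz).trans
          (((Path.Homotopic.Quotient.mk g).map f).trans (spoke p z₀ w hw).symm)) ∈ P) →
        FundamentalGroup.fromPath ((spoke p z₀ z hz).trans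
          (((Path.Homotopic.Quotient.mk g).map f).trans (spoke p z₀ w hw).symm)) ∈ P := by
      rintro _ rfl h
      exact h w hw g
    exact last (t N) (hN N le_rfl) (claim N)
  have key' : ∀ {x y : Q} (f : Path x y) (z w : D) (hz : p z = x) (hw : p w = y),
      FundamentalGroup.fromPath ((spoke p z₀ z hz).trans
        ((Path.Homotopic.Quotient.mk f).trans (spoke p z₀ w hw).symm)) ∈ P := by
    rintro x y ⟨f, rfl, rfl⟩ z w hz hw
    exact key f z w hz hw ⟨⟨id, continuous_id⟩, rfl, rfl⟩
  rw [eq_top_iff]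
  rintro γ -
  induction γ using Path.Homotopic.Quotient.ind with | mk f =>
  have h1 : spoke p z₀ z₀ rfl = .refl (p z₀) := by
    rw [spoke, Path.Homotopic.Quotient.cast_rfl_rfl]
    exact congrArg (fun γ => Path.Homotopic.Quotient.map γ p)
      (Subsingleton.elim _ (.refl z₀))
  have h2 := key' f z₀ z₀ rfl rfl
  have h3 : (Path.Homotopic.Quotient.refl (p z₀)).symm = .refl (p z₀) :=
    congrArg Path.Homotopic.Quotient.mk Path.refl_symm
  rw [h1, h3, Path.Homotopic.Quotient.refl_trans, Path.Homotopic.Quotient.trans_refl] at h2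
  exact h2

end QuotientSpace

/-! ### Polar coordinates on the polygon -/

section Polar

open Topology unitInterval

/-- The point with polar coordinates `r` and `2 π s / (4 g)`. -/
noncomputable def polar (g : ℕ) (r : I) (s : ℝ) : PolygonDisc :=
  ⟨r * Complex.exp ((2 * Real.pi * s / (4 * g) : ℝ) * Complex.I), by
    rw [mem_closedBall_zero_iff, norm_mul, Complex.norm_exp_ofReal_mul_I, mul_one,
      Complex.norm_real, Real.norm_of_nonneg r.2.1]
    exact r.2.2⟩

/-- The distance from the centre. -/
noncomputable def radius (z : PolygonDisc) : I :=
  ⟨‖(z : ℂ)‖, norm_nonneg _, mem_closedBall_zero_iff.1 z.2⟩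

/-- The angular coordinate, in which the sides have length one. -/
noncomputable def angle (g : ℕ) (z : PolygonDisc) : ℝ :=
  Complex.arg z * (4 * g) / (2 * Real.pi)

lemma polar_one (g : ℕ) (s : ℝ) : polar g 1 s = boundaryPoint g s :=
  Subtype.ext (by simp [polar, boundaryPoint])

@[fun_prop]
lemma continuous_radius : Continuous radius := by
  unfold radius; fun_prop

lemma continuous_polar (g : ℕ) : Continuous fun x : I × ℝ => polar g x.1 x.2 := by
  unfold polar; fun_prop

@[simp]
lemma radius_polar (g : ℕ) (r : I) (s : ℝ) : radius (polar g r s) = r :=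
  Subtype.ext (by
    simp only [radius, polar]
    rw [norm_mul, Complex.norm_exp_ofReal_mul_I, mul_one, Complex.norm_real,
      Real.norm_of_nonneg r.2.1])

/-- The centre of the unit interval around `s` bounded by points of `ℤ + e / 2`. -/
noncomputable def snap (e : ℕ) (s : ℝ) : ℝ := ⌊s + e / 2⌋ + 1 / 2 - e / 2

lemma snap_add_period (e : ℕ) (s : ℝ) (m : ℤ) : snap e (s + m) = snap e s + m := by
  rw [snap, snap, add_right_comm, Int.floor_add_intCast]; push_cast; ring

/-- Reflection about a half-integer or integer permutes the intervals and their centres. Interval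
ends are excluded, since the floor treats them asymmetrically. -/
lemma snap_reflect (e : ℕ) {s : ℝ} (hs : ∀ m : ℤ, s + e / 2 ≠ m) (n : ℤ) :
    snap e (n - s) = n - snap e s := by
  have h1 : ⌊(n : ℝ) - s + e / 2⌋ = n + e - ⌊s + e / 2⌋ - 1 := by
    have h2 := Int.floor_le (s + e / 2)
    have h3 := lt_of_le_of_ne h2 (hs _).symm
    have h4 := Int.lt_floor_add_one (s + e / 2)
    rw [Int.floor_eq_iff]
    push_cast
    constructor <;> linarith
  rw [snap, snap, h1]; push_cast; ring

/-- The target is the midpoint of the side or one of its ends, so straight motion towards it never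
leaves the side. -/
lemma snap_mem_Icc {e : ℕ} (he : e < 2) {s : ℝ} (hs : ∀ m : ℤ, s + e / 2 ≠ m) {k : ℤ}
    (h : s ∈ Set.Icc (k : ℝ) (k + 1)) : snap e s ∈ Set.Icc (k : ℝ) (k + 1) := by
  have h2 := Int.floor_le (s + e / 2)
  have h3 := lt_of_le_of_ne h2 (hs _).symm
  have h4 := Int.lt_floor_add_one (s + e / 2)
  obtain ⟨h5, h6⟩ := h
  rw [snap]
  have he' : e = 0 ∨ e = 1 := by omega
  have key : k ≤ ⌊s + e / 2⌋ ∧ ⌊s + e / 2⌋ ≤ k + e := by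
    constructor
    · rw [Int.le_floor]; have : (0 : ℝ) ≤ e := Nat.cast_nonneg e; linarith
    · have : (⌊s + (e : ℝ) / 2⌋ : ℝ) < k + e + 1 := by
        rcases he' with rfl | rfl <;> push_cast at * <;> linarith
      have : ⌊s + (e : ℝ) / 2⌋ < k + e + 1 := by exact_mod_cast this
      omega
  have k1 : (k : ℝ) ≤ ⌊s + (e : ℝ) / 2⌋ := by exact_mod_cast key.1
  have k2 : (⌊s + (e : ℝ) / 2⌋ : ℝ) ≤ k + e := by exact_mod_cast key.2
  rcases he' with rfl | rfl <;> push_cast at * <;> constructor <;> linarith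

lemma eventually_floor_eq {x : ℝ} (hx : ∀ m : ℤ, x ≠ m) :
    ∀ᶠ y : ℝ in 𝓝 x, ⌊y⌋ = ⌊x⌋ ∧ ∀ m : ℤ, y ≠ m := by
  have h1 : (⌊x⌋ : ℝ) < x := lt_of_le_of_ne (Int.floor_le x) (hx _).symm
  filter_upwards [Ioo_mem_nhds h1 (Int.lt_floor_add_one x)] with y hy
  have h2 : ⌊y⌋ = ⌊x⌋ := Int.floor_eq_iff.2 ⟨hy.1.le, hy.2⟩
  refine ⟨h2, fun m hm => ?_⟩
  rw [hm, Int.floor_intCast] at h2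
  rw [hm, h2] at hy
  exact lt_irrefl _ hy.1

lemma sectors_periodic (g e : ℕ) :
    Function.Periodic (fun s : ℝ => ∀ m : ℤ, s + e / 2 ≠ m) (4 * g) := by
  intro s
  refine propext ⟨fun h m hm => h (m + 4 * g) ?_, fun h m hm => h (m - 4 * g) ?_⟩ <;>
    push_cast <;> linarith

variable {g : ℕ} [NeZero g]

lemma polar_eq_polar {r : I} (hr : r ≠ 0) {s s' : ℝ} (h : polar g r s = polar g r s') :
    ∃ m : ℤ, s = s' + m * (4 * g) := by
  have h1 := congrArg Subtype.val h
  simp only [polar] at h1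
  have hr' : ((r : ℝ) : ℂ) ≠ 0 := by
    rw [Complex.ofReal_ne_zero]; exact fun h => hr (Subtype.ext h)
  obtain ⟨m, hm⟩ := Complex.exp_eq_exp_iff_exists_int.1 (mul_left_cancel₀ hr' h1)
  refine ⟨m, ?_⟩
  have h2 : ((2 * Real.pi * s / (4 * g) : ℝ) : ℂ) =
      ((2 * Real.pi * s' / (4 * g) + m * (2 * Real.pi) : ℝ) : ℂ) := by
    apply mul_right_cancel₀ Complex.I_ne_zero
    rw [hm]; push_cast; ring
  have h3 := Complex.ofReal_injective h2
  have hg : (g : ℝ) ≠ 0 := Nat.cast_ne_zero.2 (NeZero.ne g)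
  have := Real.pi_ne_zero
  field_simp at h3
  linarith

/-- Near a nonzero point there is a continuous choice of angular coordinate. -/
lemma exists_angle_lift {z : PolygonDisc} (hz : radius z ≠ 0) :
    ∃ s : PolygonDisc → ℝ, ContinuousAt s z ∧ s z = angle g z ∧
      ∀ w, polar g (radius w) (s w) = w := by
  have hg : (g : ℝ) ≠ 0 := Nat.cast_ne_zero.2 (NeZero.ne g)
  have hpi := Real.pi_ne_zero
  let u : ℂ := Complex.exp (Complex.arg z * Complex.I)
  have hu : u ≠ 0 := Complex.exp_ne_zero _
  have hnu : ‖u‖ = 1 := Complex.norm_exp_ofReal_mul_I _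
  have hzu : (z : ℂ) / u = (‖(z : ℂ)‖ : ℂ) := by
    rw [div_eq_iff hu]; exact (Complex.norm_mul_exp_arg_mul_I z).symm
  have hz0 : 0 < ‖(z : ℂ)‖ := by
    rw [norm_pos_iff]; intro h; exact hz (Subtype.ext (by simp [radius, h]))
  -- Dividing by the direction `u` of `z` moves the branch cut of `arg` away from `z`.
  refine ⟨fun w => angle g z + Complex.arg (w / u) * (4 * g) / (2 * Real.pi), ?_, ?_, ?_⟩
  · have : ContinuousAt (fun w : PolygonDisc => Complex.arg ((w : ℂ) / u)) z := by
      refine ContinuousAt.comp (g := Complex.arg) (Complex.continuousAt_arg ?_) (by fun_prop)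
      rw [hzu]
      exact Complex.ofReal_mem_slitPlane.2 hz0
    fun_prop
  · simp [hzu, Complex.arg_ofReal_of_nonneg hz0.le]
  · intro w
    refine Subtype.ext ?_
    simp only [polar, radius, angle]
    have e : (2 * Real.pi * (Complex.arg z * (4 * g) / (2 * Real.pi) +
        Complex.arg (w / u) * (4 * g) / (2 * Real.pi)) / (4 * g) : ℝ) =
        Complex.arg z + Complex.arg (w / u) := by
      field_simp
    rw [e, Complex.ofReal_add, add_mul, Complex.exp_add]
    change _ * (u * _) = _
    have h1 : ‖(w : ℂ)‖ = ‖(w : ℂ) / u‖ := by rw [norm_div, hnu, div_one]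
    rw [h1, mul_left_comm, Complex.norm_mul_exp_arg_mul_I, mul_div_cancel₀ _ hu]

lemma polar_radius_angle (z : PolygonDisc) : polar g (radius z) (angle g z) = z := by
  by_cases hz : radius z = 0
  · have : (z : ℂ) = 0 := norm_eq_zero.1 (congrArg Subtype.val hz)
    refine Subtype.ext ?_
    rw [hz, this]
    simp [polar]
  · obtain ⟨s, -, h1, h2⟩ := exists_angle_lift (g := g) hz
    rw [← h1, h2]

lemma exists_angle_eq {w : PolygonDisc} (hw : radius w ≠ 0) {s : ℝ}
    (h : polar g (radius w) s = w) : ∃ m : ℤ, s = angle g w + m * (4 * g) :=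
  polar_eq_polar hw (h.trans (polar_radius_angle w).symm)

/-- Lets the discontinuous `angle` be replaced by any other angular coordinate, in particular by a
locally continuous one. -/
lemma Function.Periodic.apply_angle {α : Type*} {F : ℝ → α} (hF : F.Periodic (4 * g))
    {w : PolygonDisc} (hw : radius w ≠ 0) {s : ℝ} (h : polar g (radius w) s = w) :
    F (angle g w) = F s := by
  obtain ⟨m, rfl⟩ := exists_angle_eq hw h
  exact (hF.int_mul m _).symm

lemma Function.Periodic.apply_angle_polar {α : Type*} {F : ℝ → α} (hF : F.Periodic (4 * g))
    {r : I} (hr : r ≠ 0) (s : ℝ) : F (angle g (polar g r s)) = F s :=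
  hF.apply_angle (by rwa [radius_polar]) (by rw [radius_polar])

lemma polar_periodic (r : I) : Function.Periodic (polar g r) (4 * g) := by
  intro s
  have hg : (g : ℝ) ≠ 0 := Nat.cast_ne_zero.2 (NeZero.ne g)
  refine Subtype.ext ?_
  simp only [polar]
  congr 1
  rw [Complex.exp_eq_exp_iff_exists_int]
  refine ⟨1, ?_⟩
  have : (2 * Real.pi * (s + 4 * g) / (4 * g) : ℝ) = 2 * Real.pi * s / (4 * g) + 2 * Real.pi := by
    field_simp
  rw [this]; push_cast; ring

/-- The points of the punctured polygon whose angular coordinate, shifted by `e / 2`, is not an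
integer. For `e = 0` these are the open sectors over the sides, for `e = 1` those around the
corners. -/
def sectors (g e : ℕ) : Set PolygonDisc :=
  {z | radius z ≠ 0 ∧ ∀ m : ℤ, angle g z + e / 2 ≠ m}

lemma polar_mem_sectors {e : ℕ} {r : I} (hr : r ≠ 0) {s : ℝ} :
    polar g r s ∈ sectors g e ↔ ∀ m : ℤ, s + e / 2 ≠ m := by
  have := (sectors_periodic g e).apply_angle_polar hr s
  simp only [sectors, Set.mem_ofPred_eq, radius_polar, this, ne_eq, hr,
    not_false_eq_true, true_and]

/-- In the sectors there is locally a continuous angular coordinate that stays in one interval. -/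
lemma exists_angle_lift_sectors {e : ℕ} {z : PolygonDisc} (hz : z ∈ sectors g e) :
    ∃ s : PolygonDisc → ℝ, ContinuousAt s z ∧ s z = angle g z ∧
      (∀ w, polar g (radius w) (s w) = w) ∧
      ∀ᶠ w in 𝓝 z, radius w ≠ 0 ∧ w ∈ sectors g e ∧ ⌊s w + e / 2⌋ = ⌊angle g z + e / 2⌋ := by
  obtain ⟨s, h1, h2, h3⟩ := exists_angle_lift (g := g) hz.1
  refine ⟨s, h1, h2, h3, ?_⟩
  have h4 : ∀ᶠ w in 𝓝 z, radius w ≠ 0 :=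
    continuous_radius.continuousAt.eventually_ne hz.1
  have h5 : ContinuousAt (fun w => s w + e / 2) z := h1.add continuousAt_const
  have h6 := h5.eventually (eventually_floor_eq (x := s z + e / 2) (h2 ▸ hz.2))
  filter_upwards [h4, h6] with w hw1 hw2
  refine ⟨hw1, ?_, h2 ▸ hw2.1⟩
  rw [← h3 w, polar_mem_sectors hw1]
  exact hw2.2

lemma isOpen_sectors (e : ℕ) : IsOpen (sectors g e) := by
  rw [isOpen_iff_mem_nhds]
  intro z hz
  obtain ⟨s, -, -, -, h⟩ := exists_angle_lift_sectors hz
  filter_upwards [h] with w hw using hw.2.1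

end Polar

/-! ### Generators and relation of the fundamental group of the surface -/

section Surface

open Topology unitInterval

/-- The projection from the polygon to the surface. -/
def surfaceProj (g : ℕ) : C(PolygonDisc, ClosedSurface g) :=
  ⟨Quot.mk (SidePairing g), continuous_quot_mk⟩

lemma isQuotientMap_surfaceProj (g : ℕ) : IsQuotientMap (surfaceProj g) := isQuotientMap_quot_mk

instance PolygonDisc.instContractibleSpace : ContractibleSpace PolygonDisc :=
  (convex_closedBall (0 : ℂ) 1).contractibleSpace ⟨0, by simp⟩

/-- The centre of the polygon. -/
def centre : PolygonDisc := ⟨0, by simp⟩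

/-- Both kinds of pairing are reflections `s ↦ n - s` of a whole side, with `n = 8j + 3` for `a_j`
and `n = 8j + 5` for `b_j`. -/
lemma SidePairing.exists_reflect {g : ℕ} {z w : PolygonDisc} (h : SidePairing g z w) :
    ∃ (k n : ℤ) (s : ℝ), s ∈ Set.Icc (k : ℝ) (k + 1) ∧ z = polar g 1 s ∧ w = polar g 1 (n - s) ∧
      ∀ s' ∈ Set.Icc (k : ℝ) (k + 1), SidePairing g (polar g 1 s') (polar g 1 (n - s')) := by
  cases h with
  | a j t ht =>
    refine ⟨4 * j, 8 * j + 3, 4 * (j : ℕ) + t, ?_, (polar_one _ _).symm, ?_, fun s' hs' => ?_⟩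
    · push_cast; constructor <;> linarith [ht.1, ht.2]
    · rw [polar_one]; congr 1; push_cast; ring
    · push_cast at hs'
      have := SidePairing.a j (s' - 4 * (j : ℕ)) ⟨by linarith [hs'.1], by linarith [hs'.2]⟩
      rw [polar_one, polar_one]
      convert this using 2 <;> push_cast <;> ring
  | b j t ht =>
    refine ⟨4 * j + 1, 8 * j + 5, 4 * (j : ℕ) + 1 + t, ?_, (polar_one _ _).symm, ?_,
      fun s' hs' => ?_⟩
    · push_cast; constructor <;> linarith [ht.1, ht.2]
    · rw [polar_one]; congr 1; push_cast; ring
    · push_cast at hs'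
      have := SidePairing.b j (s' - 4 * (j : ℕ) - 1) ⟨by linarith [hs'.1], by linarith [hs'.2]⟩
      rw [polar_one, polar_one]
      convert this using 2 <;> push_cast <;> ring

lemma SidePairing.surfaceProj_eq {g : ℕ} {z w : PolygonDisc} (h : SidePairing g z w) :
    surfaceProj g z = surfaceProj g w := Quot.sound h

/-- Functions on a saturated set that respect the side pairing descend to the surface. -/
lemma eq_of_surfaceProj_eq {g : ℕ} {α : Type*} {V : Set PolygonDisc} {f : PolygonDisc → α}
    (hV : ∀ z w, SidePairing g z w → (z ∈ V ↔ w ∈ V))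
    (hf : ∀ z w, SidePairing g z w → z ∈ V → f z = f w) {z w : PolygonDisc}
    (h : surfaceProj g z = surfaceProj g w) : (z ∈ V ↔ w ∈ V) ∧ (z ∈ V → f z = f w) := by
  classical
  let F : ClosedSurface g → Option α := Quot.lift (fun z => if z ∈ V then some (f z) else none) (by
    intro z w hzw
    by_cases hz : z ∈ V
    · simp [hz, (hV z w hzw).1 hz, hf z w hzw hz]
    · simp [hz, mt (hV z w hzw).2 hz])
  have h1 : (if z ∈ V then some (f z) else none) = if w ∈ V then some (f w) else none :=
    congrArg F h
  by_cases hz : z ∈ V <;> by_cases hw : w ∈ V <;> simp_all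

lemma mem_surfaceProj_image {g : ℕ} {V : Set PolygonDisc}
    (hV : ∀ z w, SidePairing g z w → (z ∈ V ↔ w ∈ V)) {z : PolygonDisc} :
    surfaceProj g z ∈ surfaceProj g '' V ↔ z ∈ V := by
  refine ⟨?_, fun h => ⟨z, h, rfl⟩⟩
  rintro ⟨w, hw, h⟩
  exact (eq_of_surfaceProj_eq (f := fun _ => ()) hV (fun _ _ _ _ => rfl) h).1.1 hw

lemma isOpen_surfaceProj_image {g : ℕ} {V : Set PolygonDisc}
    (hV : ∀ z w, SidePairing g z w → (z ∈ V ↔ w ∈ V)) (ho : IsOpen V) :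
    IsOpen (surfaceProj g '' V) := by
  rw [← (isQuotientMap_surfaceProj g).isOpen_preimage]
  convert ho
  exact Set.ext fun z => mem_surfaceProj_image hV

/-- The open polygon. -/
def openPolygon : Set PolygonDisc := {z | radius z ≠ 1}

lemma isOpen_openPolygon : IsOpen openPolygon := isOpen_ne.preimage continuous_radius

lemma SidePairing.radius_eq {g : ℕ} {z w : PolygonDisc} (h : SidePairing g z w) :
    radius z = 1 ∧ radius w = 1 := by
  obtain ⟨k, n, s, -, rfl, rfl, -⟩ := h.exists_reflect
  simp

lemma SidePairing.mem_openPolygon_iff {g : ℕ} (z w : PolygonDisc) (h : SidePairing g z w) :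
    z ∈ openPolygon ↔ w ∈ openPolygon := by
  simp [openPolygon, h.radius_eq.1, h.radius_eq.2]

/-- Shrinking towards the centre. -/
noncomputable def shrink : C(PolygonDisc, C(I, PolygonDisc)) :=
  ContinuousMap.curry ⟨fun x => ⟨((σ x.2 : ℝ) : ℂ) * x.1, by
    rw [mem_closedBall_zero_iff, norm_mul, Complex.norm_real, Real.norm_of_nonneg (σ x.2).2.1]
    exact mul_le_one₀ (σ x.2).2.2 (norm_nonneg _) (mem_closedBall_zero_iff.1 x.1.2)⟩, by fun_prop⟩

/-- No interior point is paired with another, so compatibility is vacuous on generators, and all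
curves end at the centre. -/
lemma isContraction_shrink (g : ℕ) :
    IsContraction (surfaceProj g) (surfaceProj g '' openPolygon) shrink where
  isOpen := isOpen_surfaceProj_image SidePairing.mem_openPolygon_iff isOpen_openPolygon
  continuousOn := shrink.continuous.continuousOn
  start z _ := Subtype.ext (by simp [shrink])
  compat z w h hz t := by
    rw [mem_surfaceProj_image SidePairing.mem_openPolygon_iff] at hz
    refine (eq_of_surfaceProj_eq (f := fun z => surfaceProj g (shrink z t))
      SidePairing.mem_openPolygon_iff (fun z w h hz => ?_) h).2 hz
    exact absurd h.radius_eq.1 hz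
  eventually_eq z _ := Filter.Eventually.of_forall fun w => by
    congr 1
    exact Subtype.ext (by simp [shrink])

/-- The curves along which the sectors contract. -/
noncomputable def snapCurve (g : ℕ) (b : ℝ) : C(I × ℝ, C(I, PolygonDisc)) :=
  ContinuousMap.curry ⟨fun x => polar g (σ (σ x.1.1 * σ x.2)) ((1 - x.2) * x.1.2 + x.2 * b),
    (continuous_polar g).comp (f := fun x : (I × ℝ) × I =>
      (σ (σ x.1.1 * σ x.2), (1 - (x.2 : ℝ)) * x.1.2 + x.2 * b)) (by fun_prop)⟩

/-- The radius is `1 - (1 - r) * (1 - t)`: it grows from `r` to `1`, and boundary points stay on the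
boundary. -/
lemma snapCurve_apply (g : ℕ) (b : ℝ) (r : I) (s : ℝ) (t : I) :
    snapCurve g b (r, s) t = polar g (σ (σ r * σ t)) ((1 - t) * s + t * b) := rfl

/-- The contraction of the sectors. -/
noncomputable def sectorSnap (g e : ℕ) (z : PolygonDisc) : C(I, PolygonDisc) :=
  snapCurve g (snap e (angle g z)) (radius z, angle g z)

variable {g : ℕ} [NeZero g]

/-- A full turn shifts the start and the target alike, so the curve does not depend on the choice of
angular coordinate. -/
lemma sectorSnap_eq (e : ℕ) {z : PolygonDisc} (hz : radius z ≠ 0) {s : ℝ}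
    (h : polar g (radius z) s = z) : sectorSnap g e z = snapCurve g (snap e s) (radius z, s) := by
  refine Function.Periodic.apply_angle (g := g)
    (F := fun s => snapCurve g (snap e s) (radius z, s)) (fun s => ?_) hz h
  ext1 t
  have h1 := snap_add_period e s (4 * g)
  push_cast at h1
  simp only [snapCurve_apply]
  rw [h1, ← polar_periodic _ ((1 - t) * s + t * snap e s)]
  congr 1; ring

lemma SidePairing.mem_sectors_iff (e : ℕ) (z w : PolygonDisc) (h : SidePairing g z w) :
    z ∈ sectors g e ↔ w ∈ sectors g e := by
  obtain ⟨k, n, s, -, rfl, rfl, -⟩ := h.exists_reflect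
  rw [polar_mem_sectors one_ne_zero, polar_mem_sectors one_ne_zero]
  refine ⟨fun h m hm => h (n + e - m) ?_, fun h m hm => h (n + e - m) ?_⟩ <;>
    push_cast <;> linarith

/-- Near a point of a sector the target is constant and the angle can be chosen continuously. Paired
boundary points move along paired sides in mirror image, hence stay paired. -/
lemma isContraction_sectorSnap {e : ℕ} (he : e < 2) :
    IsContraction (surfaceProj g) (surfaceProj g '' sectors g e) (sectorSnap g e) where
  isOpen := isOpen_surfaceProj_image (SidePairing.mem_sectors_iff e) (isOpen_sectors e)
  continuousOn z hz := by
    replace hz := (mem_surfaceProj_image (SidePairing.mem_sectors_iff e)).1 hz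
    refine ContinuousAt.continuousWithinAt ?_
    obtain ⟨s, h1, h2, h3, h4⟩ := exists_angle_lift_sectors hz
    have : sectorSnap g e =ᶠ[𝓝 z]
        fun w => snapCurve g (snap e (angle g z)) (radius w, s w) := by
      filter_upwards [h4] with w hw
      rw [sectorSnap_eq e hw.1 (h3 w), snap, hw.2.2, snap]
    refine ContinuousAt.congr ?_ this.symm
    exact (snapCurve g _).continuous.continuousAt.comp
      (continuous_radius.continuousAt.prodMk h1)
  start z _ := by
    rw [sectorSnap, snapCurve_apply]
    simp [polar_radius_angle]
  compat z w h hz t := by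
    rw [mem_surfaceProj_image (SidePairing.mem_sectors_iff e)] at hz
    refine (eq_of_surfaceProj_eq (f := fun z => surfaceProj g (sectorSnap g e z t))
      (SidePairing.mem_sectors_iff e) (fun z w h hz => ?_) h).2 hz
    obtain ⟨k, n, s, hs, rfl, rfl, hp⟩ := h.exists_reflect
    rw [polar_mem_sectors one_ne_zero] at hz
    rw [sectorSnap_eq e (s := s) (by simp) (by simp),
      sectorSnap_eq e (s := n - s) (by simp) (by simp), snapCurve_apply, snapCurve_apply,
      snap_reflect e hz, radius_polar, radius_polar]
    simp only [unitInterval.symm_one, zero_mul, unitInterval.symm_zero]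
    have h1 := snap_mem_Icc he hz hs
    have h2 := t.2.1
    have h3 := t.2.2
    have := hp ((1 - t) * s + t * snap e s) ⟨by nlinarith [h1.1, hs.1], by nlinarith [h1.2, hs.2]⟩
    convert this.surfaceProj_eq using 3
    ring
  eventually_eq z hz := by
    replace hz := (mem_surfaceProj_image (SidePairing.mem_sectors_iff e)).1 hz
    obtain ⟨s, h1, h2, h3, h4⟩ := exists_angle_lift_sectors hz
    filter_upwards [h4] with w hw
    rw [sectorSnap_eq e hw.1 (h3 w), sectorSnap, snapCurve_apply, snapCurve_apply, snap, hw.2.2,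
      snap]
    simp

/-- The three saturated open sets that cover the polygon. -/
def patch (g : ℕ) : Option (Fin 2) → Set PolygonDisc
  | none => openPolygon
  | some e => sectors g e

lemma SidePairing.mem_patch_iff (i : Option (Fin 2)) (z w : PolygonDisc)
    (h : SidePairing g z w) : z ∈ patch g i ↔ w ∈ patch g i := by
  cases i with
  | none => exact SidePairing.mem_openPolygon_iff z w h
  | some e => exact SidePairing.mem_sectors_iff e z w h

lemma isOpen_patch (i : Option (Fin 2)) : IsOpen (patch g i) := by
  cases i with
  | none => exact isOpen_openPolygon
  | some e => exact isOpen_sectors e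

lemma exists_mem_patch (g : ℕ) (z : PolygonDisc) : ∃ i, z ∈ patch g i := by
  by_cases h : radius z = 1
  · by_cases h' : ∃ m : ℤ, angle g z = m
    · obtain ⟨m, hm⟩ := h'
      refine ⟨some 1, by simp [h], fun n hn => ?_⟩
      rw [hm, show ((1 : Fin 2) : ℕ) = 1 from rfl] at hn
      have : (2 * m + 1 : ℝ) = 2 * n := by rw [← hn]; push_cast; ring
      have : 2 * m + 1 = 2 * n := by exact_mod_cast this
      omega
    · exact ⟨some 0, by simp [h], fun n hn => h' ⟨n, by simpa using hn⟩⟩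
  · exact ⟨none, h⟩

/-- The contractions of the patches. -/
noncomputable def patchContraction (g : ℕ) : Option (Fin 2) → PolygonDisc → C(I, PolygonDisc)
  | none => shrink
  | some e => sectorSnap g e

lemma isContraction_patchContraction (i : Option (Fin 2)) :
    IsContraction (surfaceProj g) (surfaceProj g '' patch g i) (patchContraction g i) := by
  cases i with
  | none => exact isContraction_shrink g
  | some e => exact isContraction_sectorSnap e.2

lemma iUnion_surfaceProj_patch (g : ℕ) : ⋃ i, surfaceProj g '' patch g i = Set.univ := by
  refine Set.eq_univ_of_forall fun x => ?_
  obtain ⟨z, rfl⟩ := (isQuotientMap_surfaceProj g).surjective x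
  obtain ⟨i, hi⟩ := exists_mem_patch g z
  exact Set.mem_iUnion.2 ⟨i, z, hi, rfl⟩

end Surface

/-! ### Generating loops and the surface relation -/

section Generators

variable {g : ℕ}

open unitInterval

/-- A loop of the form `jump` does not change when its end points move along paired sides. -/
lemma jump_side_eq {a b n : ℝ}
    (h : ∀ s ∈ Set.Icc a b, surfaceProj g (polar g 1 s) = surfaceProj g (polar g 1 (n - s)))
    {s s' : ℝ} (hs : s ∈ Set.Icc a b) (hs' : s' ∈ Set.Icc a b) :
    jump (surfaceProj g) centre (polar g 1 s) (polar g 1 (n - s)) (h s hs) =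
      jump (surfaceProj g) centre (polar g 1 s') (polar g 1 (n - s')) (h s' hs') := by
  have hc : ∀ u : I → ℝ, Continuous u → Continuous fun t => polar g 1 (u t) := fun u hu =>
    (continuous_polar g).comp (f := fun t => ((1 : I), u t)) (by fun_prop)
  let f : Path (polar g 1 s) (polar g 1 s') :=
    ⟨⟨fun t => polar g 1 ((1 - t) * s + t * s'), hc _ (by fun_prop)⟩, by simp, by simp⟩
  let f' : Path (polar g 1 (n - s)) (polar g 1 (n - s')) :=
    ⟨⟨fun t => polar g 1 (n - ((1 - t) * s + t * s')), hc _ (by fun_prop)⟩, by simp, by simp⟩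
  refine jump_congr_of_paths _ _ f f' (fun t => h _ ⟨?_, ?_⟩) _ _ <;>
    nlinarith [t.2.1, t.2.2, hs.1, hs.2, hs'.1, hs'.2]

/-- The loop from the centre to the corner `m` and back from the corner `n`. -/
noncomputable def cornerLoop (g m n : ℕ) : FundamentalGroup (ClosedSurface g)
    (surfaceProj g centre) :=
  open Classical in
  if h : surfaceProj g (polar g 1 m) = surfaceProj g (polar g 1 n) then
    jump (surfaceProj g) centre (polar g 1 m) (polar g 1 n) h else 1

lemma cornerLoop_eq {m n : ℕ} (h : surfaceProj g (polar g 1 m) = surfaceProj g (polar g 1 n)) :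
    cornerLoop g m n = jump (surfaceProj g) centre (polar g 1 m) (polar g 1 n) h := dif_pos h

/-- The generator belonging to the side `a_j`. -/
noncomputable def loopA (g j : ℕ) := cornerLoop g (4 * j) (4 * j + 3)

/-- The generator belonging to the side `b_j`. -/
noncomputable def loopB (g j : ℕ) := cornerLoop g (4 * j + 1) (4 * j + 4)

lemma surfaceProj_a {j : ℕ} (hj : j < g) (s : ℝ) (hs : s ∈ Set.Icc (4 * j : ℝ) (4 * j + 1)) :
    surfaceProj g (polar g 1 s) = surfaceProj g (polar g 1 (8 * j + 3 - s)) := by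
  have := SidePairing.surfaceProj_eq (SidePairing.a (⟨j, hj⟩ : Fin g) (s - 4 * j)
    ⟨by linarith [hs.1], by linarith [hs.2]⟩)
  rw [polar_one, polar_one]
  convert this using 3 <;> ring

lemma surfaceProj_b {j : ℕ} (hj : j < g) (s : ℝ)
    (hs : s ∈ Set.Icc (4 * j + 1 : ℝ) (4 * j + 2)) :
    surfaceProj g (polar g 1 s) = surfaceProj g (polar g 1 (8 * j + 5 - s)) := by
  have := SidePairing.surfaceProj_eq (SidePairing.b (⟨j, hj⟩ : Fin g) (s - 4 * j - 1)
    ⟨by linarith [hs.1], by linarith [hs.2]⟩)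
  rw [polar_one, polar_one]
  convert this using 3 <;> ring

/-- Sliding along the side shows that its two ends and all points between define the same loop. -/
lemma cornerLoop_a {j : ℕ} (hj : j < g) {s : ℝ} (hs : s ∈ Set.Icc (4 * j : ℝ) (4 * j + 1)) {m n : ℕ}
    (hm : (m : ℝ) ∈ Set.Icc (4 * j : ℝ) (4 * j + 1)) (hmn : m + n = 8 * j + 3) :
    surfaceProj g (polar g 1 m) = surfaceProj g (polar g 1 n) ∧
    cornerLoop g m n = jump (surfaceProj g) centre _ _ (surfaceProj_a hj s hs) := by
  have hn : (n : ℝ) = 8 * j + 3 - m := by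
    have : (m + n : ℝ) = 8 * j + 3 := by exact_mod_cast hmn
    linarith
  have h : surfaceProj g (polar g 1 m) = surfaceProj g (polar g 1 n) := by
    rw [hn]; exact surfaceProj_a hj m hm
  refine ⟨h, ?_⟩
  rw [cornerLoop_eq h]
  simp only [hn]
  exact jump_side_eq (surfaceProj_a hj) hm hs

lemma cornerLoop_b {j : ℕ} (hj : j < g) {s : ℝ} (hs : s ∈ Set.Icc (4 * j + 1 : ℝ) (4 * j + 2))
    {m n : ℕ} (hm : (m : ℝ) ∈ Set.Icc (4 * j + 1 : ℝ) (4 * j + 2)) (hmn : m + n = 8 * j + 5) :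
    surfaceProj g (polar g 1 m) = surfaceProj g (polar g 1 n) ∧
    cornerLoop g m n = jump (surfaceProj g) centre _ _ (surfaceProj_b hj s hs) := by
  have hn : (n : ℝ) = 8 * j + 5 - m := by
    have : (m + n : ℝ) = 8 * j + 5 := by exact_mod_cast hmn
    linarith
  have h : surfaceProj g (polar g 1 m) = surfaceProj g (polar g 1 n) := by
    rw [hn]; exact surfaceProj_b hj m hm
  refine ⟨h, ?_⟩
  rw [cornerLoop_eq h]
  simp only [hn]
  exact jump_side_eq (surfaceProj_b hj) hm hs

lemma loopA_eq {j : ℕ} (hj : j < g) {s : ℝ} (hs : s ∈ Set.Icc (4 * j : ℝ) (4 * j + 1)) :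
    loopA g j = jump (surfaceProj g) centre _ _ (surfaceProj_a hj s hs) :=
  (cornerLoop_a hj hs (by push_cast; simp) (by ring)).2

lemma loopB_eq {j : ℕ} (hj : j < g) {s : ℝ} (hs : s ∈ Set.Icc (4 * j + 1 : ℝ) (4 * j + 2)) :
    loopB g j = jump (surfaceProj g) centre _ _ (surfaceProj_b hj s hs) :=
  (cornerLoop_b hj hs (by push_cast; constructor <;> linarith) (by ring)).2

/-- Going around the corners of the polygon shows that the product of the handles is trivial. -/
theorem handleProd_loops (g : ℕ) [NeZero g] : handleProd (loopA g) (loopB g) g = 1 := by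
  have key : ∀ n ≤ g, ∃ h : surfaceProj g (polar g 1 (0 : ℕ)) =
      surfaceProj g (polar g 1 (4 * n : ℕ)),
      jump (surfaceProj g) centre _ _ h = handleProd (loopA g) (loopB g) n := by
    intro n
    induction n with
    | zero => exact fun _ => ⟨rfl, jump_self _ _ _⟩
    | succ n ih =>
      intro hn
      obtain ⟨h, ih⟩ := ih (by omega)
      have hj : n < g := hn
      have a1 := cornerLoop_a hj (s := 4 * n) (m := 4 * n) (n := 4 * n + 3) (by simp)
        (by push_cast; simp) (by ring)
      have a2 := cornerLoop_a hj (s := 4 * n) (m := 4 * n + 1) (n := 4 * n + 2) (by simp)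
        (by push_cast; simp) (by ring)
      have b1 := cornerLoop_b hj (s := 4 * n + 1) (m := 4 * n + 1) (n := 4 * n + 4)
        ⟨le_rfl, by linarith⟩ (by push_cast; constructor <;> linarith) (by ring)
      have b2 := cornerLoop_b hj (s := 4 * n + 1) (m := 4 * n + 2) (n := 4 * n + 3)
        ⟨le_rfl, by linarith⟩ (by push_cast; constructor <;> linarith) (by ring)
      have eA : loopA g n = jump _ _ _ _ a1.1 := cornerLoop_eq a1.1
      have eA' : loopA g n = jump _ _ _ _ a2.1 := by
        rw [← cornerLoop_eq a2.1, a2.2]; exact a1.2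
      have eB : loopB g n = jump _ _ _ _ b1.1 := cornerLoop_eq b1.1
      have eB' : loopB g n = jump _ _ _ _ b2.1 := by
        rw [← cornerLoop_eq b2.1, b2.2]; exact b1.2
      -- The corners are visited in the order `4n`, `4n + 3`, `4n + 2`, `4n + 1`, `4n + 4`, by `a`,
      -- `b⁻¹`, `a⁻¹`, `b`; read from right to left this is one handle.
      refine ⟨h.trans (a1.1.trans (b2.1.symm.trans (a2.1.symm.trans b1.1))), ?_⟩
      rw [handleProd, handle, ← ih]
      nth_rw 1 [eB]
      nth_rw 1 [eA']
      rw [eB', eA, jump_inv, jump_inv, jump_mul, jump_mul, jump_mul, jump_mul]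
      rfl
  obtain ⟨h, hg⟩ := key g le_rfl
  rw [← hg]
  -- The circuit closes up in the polygon itself, so the total jump is from a point to itself.
  have e : polar g 1 (4 * g : ℕ) = polar g 1 (0 : ℕ) := by
    have := polar_periodic (g := g) 1 0
    push_cast
    simpa using this
  generalize polar g 1 (4 * g : ℕ) = z at *
  subst e
  exact jump_self _ _ _

/-- The loops `loopA` and `loopB` generate the fundamental group. -/
theorem closure_loops (g : ℕ) [NeZero g] :
    Subgroup.closure (loopA g '' Set.Iio g ∪ loopB g '' Set.Iio g) = ⊤ := by
  refine eq_top_of_jump_mem (isQuotientMap_surfaceProj g) centre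
    (isContraction_patchContraction (g := g)) (iUnion_surfaceProj_patch g) _ fun z w h => ?_
  -- Identified points are linked by a chain of side pairings, and `jump` is multiplicative along
  -- chains.
  have hzw : Relation.EqvGen (SidePairing g) z w := Quot.eqvGen_exact h
  induction hzw with
  | rel z w hzw =>
    cases hzw with
    | a j t ht =>
      have hs : 4 * (j : ℕ) + t ∈ Set.Icc (4 * (j : ℕ) : ℝ) (4 * (j : ℕ) + 1) :=
        ⟨by linarith [ht.1], by linarith [ht.2]⟩
      refine Subgroup.subset_closure (Or.inl ⟨j, j.2, ?_⟩)
      rw [loopA_eq j.2 hs]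
      congr 1
      · rw [polar_one]
      · rw [polar_one]; congr 1; ring
    | b j t ht =>
      have hs : 4 * (j : ℕ) + 1 + t ∈ Set.Icc (4 * (j : ℕ) + 1 : ℝ) (4 * (j : ℕ) + 2) :=
        ⟨by linarith [ht.1], by linarith [ht.2]⟩
      refine Subgroup.subset_closure (Or.inr ⟨j, j.2, ?_⟩)
      rw [loopB_eq j.2 hs]
      congr 1
      · rw [polar_one]
      · rw [polar_one]; congr 1; ring
  | refl z => rw [jump_self]; exact one_mem _
  | symm z w _ ih => rw [← jump_inv _ _ h.symm]; exact inv_mem (ih h.symm)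
  | trans z v w h1 h2 ih1 ih2 =>
    have e1 : surfaceProj g z = surfaceProj g v := Quot.eqvGen_sound h1
    have e2 : surfaceProj g v = surfaceProj g w := Quot.eqvGen_sound h2
    rw [← jump_mul _ _ e1 e2]
    exact mul_mem (ih2 e2) (ih1 e1)

end Generators

/-! ### Coverings of the surface and their monodromy -/

section Labels

variable {G : Type*} [Group G]

/-- Labels of the sides. -/
def sideLabel (A B : ℕ → G) (i : ℕ) : G :=
  if i % 4 = 2 then A (i / 4) else if i % 4 = 3 then B (i / 4) else 1

/-- Labels of the corners. -/
def cornerLabel (A B : ℕ → G) (i : ℕ) : G :=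
  if i % 4 = 0 then handleProd A B (i / 4)
  else if i % 4 = 1 then (B (i / 4))⁻¹ * handleProd A B (i / 4 + 1)
  else if i % 4 = 2 then (B (i / 4))⁻¹ * A (i / 4) * handleProd A B (i / 4)
  else A (i / 4) * handleProd A B (i / 4)

/-- Labels of the sides (`e = 0`) or the corners (`e = 1`) of a `4 g`-gon. -/
def polygonLabel (g : ℕ) (A B : ℕ → G) (e : Fin 2) (k : ℤ) : G :=
  (if e = 0 then sideLabel A B else cornerLabel A B) (k % (4 * g)).toNat

lemma polygonLabel_periodic (g : ℕ) (A B : ℕ → G) (e : Fin 2) (k : ℤ) :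
    polygonLabel g A B e (k + 4 * g) = polygonLabel g A B e k := by
  simp [polygonLabel]

lemma polygonLabel_zero {g : ℕ} {A B : ℕ → G} {i : ℕ} (hi : i < 4 * g) :
    polygonLabel g A B 0 i = sideLabel A B i := by
  have : ((i : ℤ) % (4 * g)).toNat = i := by
    rw [Int.emod_eq_of_lt (by omega) (by omega)]; simp
  rw [polygonLabel, this]; simp

/-- The case `i = 4g` is where the relation enters: the corner labels, continued once around the
polygon, return to their initial value. -/
lemma polygonLabel_one {g : ℕ} {A B : ℕ → G} (hAB : handleProd A B g = 1) {i : ℕ}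
    (hi : i ≤ 4 * g) : polygonLabel g A B 1 i = cornerLabel A B i := by
  rcases hi.lt_or_eq with hi | rfl
  · have : ((i : ℤ) % (4 * g)).toNat = i := by
      rw [Int.emod_eq_of_lt (by omega) (by omega)]; simp
    rw [polygonLabel, this]; simp
  · have : (((4 * g : ℕ) : ℤ) % (4 * g)).toNat = 0 := by push_cast; simp
    rw [polygonLabel, this]
    have e : 4 * g / 4 = g := by omega
    simp [cornerLabel, e, hAB, handleProd]

lemma floor_eq_natCast {x : ℝ} {i : ℕ} (h1 : (i : ℝ) ≤ x) (h2 : x < i + 1) : ⌊x⌋ = (i : ℤ) :=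
  Int.floor_eq_iff.2 ⟨by exact_mod_cast h1, by exact_mod_cast h2⟩

lemma sideLabel_four_mul_add (A B : ℕ → G) (j : ℕ) {r : ℕ} (hr : r < 4) :
    sideLabel A B (4 * j + r) = if r = 2 then A j else if r = 3 then B j else 1 := by
  rw [sideLabel, show (4 * j + r) % 4 = r by omega, show (4 * j + r) / 4 = j by omega]

lemma cornerLabel_four_mul_add (A B : ℕ → G) (j : ℕ) {r : ℕ} (hr : r < 4) :
    cornerLabel A B (4 * j + r) = if r = 0 then handleProd A B j
      else if r = 1 then (B j)⁻¹ * handleProd A B (j + 1)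
      else if r = 2 then (B j)⁻¹ * A j * handleProd A B j else A j * handleProd A B j := by
  rw [cornerLabel, show (4 * j + r) % 4 = r by omega, show (4 * j + r) / 4 = j by omega]

/-- Labels of sides and corners change by `A j` across the sides `a_j`. -/
lemma polygonLabel_a {g : ℕ} {A B : ℕ → G} (hAB : handleProd A B g = 1) {j : ℕ} (hj : j < g)
    (e : Fin 2) {t : ℝ} (ht : t ∈ Set.Icc (0 : ℝ) 1) (hn : ∀ m : ℤ, 4 * j + t + (e : ℕ) / 2 ≠ m) :
    polygonLabel g A B e ⌊4 * j + 3 - t + (e : ℕ) / 2⌋ =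
      A j * polygonLabel g A B e ⌊4 * j + t + (e : ℕ) / 2⌋ := by
  obtain ⟨h0, h1⟩ := ht
  fin_cases e
  · have k0 : t ≠ 0 := fun h => hn (4 * j) (by simp [h])
    have k1 : t ≠ 1 := fun h => hn (4 * j + 1) (by simp [h])
    have k0 : 0 < t := lt_of_le_of_ne h0 k0.symm
    have k1 : t < 1 := lt_of_le_of_ne h1 k1
    rw [floor_eq_natCast (x := 4 * j + t + _) (i := 4 * j + 0) (by push_cast; simp; linarith)
        (by push_cast; simp; linarith),
      floor_eq_natCast (i := 4 * j + 2) (by push_cast; simp; linarith)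
        (by push_cast; simp; linarith)]
    simp only [Fin.zero_eta]
    rw [polygonLabel_zero (by omega), polygonLabel_zero (by omega),
      sideLabel_four_mul_add _ _ _ (by omega), sideLabel_four_mul_add _ _ _ (by omega)]
    simp
  · have k0 : t ≠ 1 / 2 := fun h => hn (4 * j + 1) (by simp [h]; norm_num [add_assoc])
    simp only [Fin.mk_one, Fin.isValue, Nat.cast_one]
    rcases lt_or_gt_of_ne k0 with k0 | k0
    · rw [floor_eq_natCast (x := 4 * j + t + _) (i := 4 * j + 0) (by push_cast; linarith)
          (by push_cast; linarith),
        floor_eq_natCast (i := 4 * j + 3) (by push_cast; linarith) (by push_cast; linarith),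
        polygonLabel_one hAB (by omega), polygonLabel_one hAB (by omega),
        cornerLabel_four_mul_add _ _ _ (by omega), cornerLabel_four_mul_add _ _ _ (by omega)]
      simp
    -- The corners are `4j + 1` and `4j + 2`; the former label contains one more handle, and
    -- unfolding it gives the factor `A j`.
    · rw [floor_eq_natCast (x := 4 * j + t + _) (i := 4 * j + 1) (by push_cast; linarith)
          (by push_cast; linarith),
        floor_eq_natCast (i := 4 * j + 2) (by push_cast; linarith) (by push_cast; linarith),
        polygonLabel_one hAB (by omega), polygonLabel_one hAB (by omega),
        cornerLabel_four_mul_add _ _ _ (by omega), cornerLabel_four_mul_add _ _ _ (by omega)]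
      simp [handleProd, handle, mul_assoc]

/-- Labels of sides and corners change by `B j` across the sides `b_j`. -/
lemma polygonLabel_b {g : ℕ} {A B : ℕ → G} (hAB : handleProd A B g = 1) {j : ℕ} (hj : j < g)
    (e : Fin 2) {t : ℝ} (ht : t ∈ Set.Icc (0 : ℝ) 1)
    (hn : ∀ m : ℤ, 4 * j + 1 + t + (e : ℕ) / 2 ≠ m) :
    polygonLabel g A B e ⌊4 * j + 4 - t + (e : ℕ) / 2⌋ =
      B j * polygonLabel g A B e ⌊4 * j + 1 + t + (e : ℕ) / 2⌋ := by
  obtain ⟨h0, h1⟩ := ht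
  fin_cases e
  · have k0 : t ≠ 0 := fun h => hn (4 * j + 1) (by simp [h])
    have k1 : t ≠ 1 := fun h => hn (4 * j + 2) (by simp [h]; ring)
    have k0 : 0 < t := lt_of_le_of_ne h0 k0.symm
    have k1 : t < 1 := lt_of_le_of_ne h1 k1
    rw [floor_eq_natCast (x := 4 * j + 1 + t + _) (i := 4 * j + 1) (by push_cast; simp; linarith)
        (by push_cast; simp; linarith),
      floor_eq_natCast (i := 4 * j + 3) (by push_cast; simp; linarith)
        (by push_cast; simp; linarith)]
    simp only [Fin.zero_eta]
    rw [polygonLabel_zero (by omega), polygonLabel_zero (by omega),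
      sideLabel_four_mul_add _ _ _ (by omega), sideLabel_four_mul_add _ _ _ (by omega)]
    simp
  · have k0 : t ≠ 1 / 2 := fun h => hn (4 * j + 2) (by simp [h]; ring)
    simp only [Fin.mk_one, Fin.isValue, Nat.cast_one]
    rcases lt_or_gt_of_ne k0 with k0 | k0
    · rw [floor_eq_natCast (x := 4 * j + 1 + t + _) (i := 4 * j + 1) (by push_cast; linarith)
          (by push_cast; linarith),
        floor_eq_natCast (i := 4 * (j + 1) + 0) (by push_cast; linarith) (by push_cast; linarith),
        polygonLabel_one hAB (by omega), polygonLabel_one hAB (by omega),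
        cornerLabel_four_mul_add _ _ _ (by omega), cornerLabel_four_mul_add _ _ _ (by omega)]
      simp
    · rw [floor_eq_natCast (x := 4 * j + 1 + t + _) (i := 4 * j + 2) (by push_cast; linarith)
          (by push_cast; linarith),
        floor_eq_natCast (i := 4 * j + 3) (by push_cast; linarith) (by push_cast; linarith),
        polygonLabel_one hAB (by omega), polygonLabel_one hAB (by omega),
        cornerLabel_four_mul_add _ _ _ (by omega), cornerLabel_four_mul_add _ _ _ (by omega)]
      simp [mul_assoc]

end Labels

/-! ### Patch labels and their transition functions -/

section Covering

open Topology unitInterval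

variable {G : Type*} [Group G]

/-- A point of the polygon above a point of the surface. -/
noncomputable def liftPoint {g : ℕ} (x : ClosedSurface g) : PolygonDisc :=
  ((isQuotientMap_surfaceProj g).surjective x).choose

lemma surfaceProj_liftPoint {g : ℕ} (x : ClosedSurface g) : surfaceProj g (liftPoint x) = x :=
  ((isQuotientMap_surfaceProj g).surjective x).choose_spec

/-- The label of the component of a patch containing a given point. -/
noncomputable def patchLabel (g : ℕ) (A B : ℕ → G) : Option (Fin 2) → PolygonDisc → G
  | none, _ => 1
  | some e, z => polygonLabel g A B e ⌊angle g z + (e : ℕ) / 2⌋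

variable {g : ℕ} [NeZero g] {A B : ℕ → G}

lemma patchLabel_eq (e : Fin 2) {z : PolygonDisc} (hz : radius z ≠ 0) {s : ℝ}
    (h : polar g (radius z) s = z) :
    patchLabel g A B (some e) z = polygonLabel g A B e ⌊s + (e : ℕ) / 2⌋ := by
  refine Function.Periodic.apply_angle (g := g)
    (F := fun s => polygonLabel g A B e ⌊s + (e : ℕ) / 2⌋) (fun s => ?_) hz h
  have : s + 4 * g + (e : ℕ) / 2 = s + (e : ℕ) / 2 + ((4 * g : ℤ) : ℝ) := by push_cast; ring
  simp only
  rw [this, Int.floor_add_intCast, polygonLabel_periodic]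

lemma eventually_patchLabel_eq (i : Option (Fin 2)) {z : PolygonDisc} (hz : z ∈ patch g i) :
    ∀ᶠ w in 𝓝 z, patchLabel g A B i w = patchLabel g A B i z := by
  cases i with
  | none => exact Filter.Eventually.of_forall fun _ => rfl
  | some e =>
    obtain ⟨s, -, -, h3, h4⟩ := exists_angle_lift_sectors hz
    filter_upwards [h4] with w hw
    rw [patchLabel_eq e hw.1 (h3 w), hw.2.2, patchLabel]

lemma patchLabel_a (hAB : handleProd A B g = 1) (i : Option (Fin 2)) (j : Fin g) {t : ℝ}
    (ht : t ∈ Set.Icc (0 : ℝ) 1) (hz : boundaryPoint g (4 * (j : ℕ) + t) ∈ patch g i) :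
    patchLabel g A B i (boundaryPoint g (4 * (j : ℕ) + 3 - t)) =
      A j * patchLabel g A B i (boundaryPoint g (4 * (j : ℕ) + t)) := by
  rw [← polar_one] at hz
  rw [← polar_one, ← polar_one]
  cases i with
  | none => exact absurd (radius_polar g 1 _) hz
  | some e =>
    rw [patchLabel_eq e (s := 4 * (j : ℕ) + 3 - t) (by simp) (by simp),
      patchLabel_eq e (s := 4 * (j : ℕ) + t) (by simp) (by simp)]
    exact polygonLabel_a hAB j.2 e ht ((polar_mem_sectors one_ne_zero).1 hz)

lemma patchLabel_b (hAB : handleProd A B g = 1) (i : Option (Fin 2)) (j : Fin g) {t : ℝ}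
    (ht : t ∈ Set.Icc (0 : ℝ) 1) (hz : boundaryPoint g (4 * (j : ℕ) + 1 + t) ∈ patch g i) :
    patchLabel g A B i (boundaryPoint g (4 * (j : ℕ) + 4 - t)) =
      B j * patchLabel g A B i (boundaryPoint g (4 * (j : ℕ) + 1 + t)) := by
  rw [← polar_one] at hz
  rw [← polar_one, ← polar_one]
  cases i with
  | none => exact absurd (radius_polar g 1 _) hz
  | some e =>
    rw [patchLabel_eq e (s := 4 * (j : ℕ) + 4 - t) (by simp) (by simp),
      patchLabel_eq e (s := 4 * (j : ℕ) + 1 + t) (by simp) (by simp)]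
    exact polygonLabel_b hAB j.2 e ht ((polar_mem_sectors one_ne_zero).1 hz)

/-- Crossing a side multiplies both labels on the left by the same element, which cancels. Hence
this quotient descends to the surface as a transition function. -/
lemma patchLabel_inv_mul_eq (hAB : handleProd A B g = 1) {i k : Option (Fin 2)}
    {z w : PolygonDisc} (h : surfaceProj g z = surfaceProj g w) (hi : z ∈ patch g i)
    (hk : z ∈ patch g k) :
    (patchLabel g A B k z)⁻¹ * patchLabel g A B i z =
      (patchLabel g A B k w)⁻¹ * patchLabel g A B i w := by
  refine (eq_of_surfaceProj_eq (V := patch g i ∩ patch g k)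
    (f := fun z => (patchLabel g A B k z)⁻¹ * patchLabel g A B i z)
    (fun z w h => and_congr (h.mem_patch_iff i) (h.mem_patch_iff k)) (fun z w h hz => ?_) h).2
    ⟨hi, hk⟩
  cases h with
  | a j t ht =>
    simp only [patchLabel_a hAB i j ht hz.1, patchLabel_a hAB k j ht hz.2]
    group
  | b j t ht =>
    simp only [patchLabel_b hAB i j ht hz.1, patchLabel_b hAB k j ht hz.2]
    group

end Covering

/-! ### The covering with prescribed monodromy -/

section Monodromy

open Topology unitInterval Bundle

lemma exists_mem_image_patch {g : ℕ} (x : ClosedSurface g) : ∃ i, x ∈ surfaceProj g '' patch g i :=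
  Set.mem_iUnion.1 (iUnion_surfaceProj_patch g ▸ Set.mem_univ x)

variable {Y : Type} [TopologicalSpace Y] [DiscreteTopology Y] {g : ℕ} [NeZero g]
  {A B : ℕ → Equiv.Perm Y}

/-- The covering of the surface with fibre `Y` whose holonomy is given by `A` and `B`. -/
noncomputable def coveringCore (hAB : handleProd A B g = 1) :
    FiberBundleCore (Option (Fin 2)) (ClosedSurface g) Y where
  baseSet i := surfaceProj g '' patch g i
  isOpen_baseSet i := isOpen_surfaceProj_image (SidePairing.mem_patch_iff i) (isOpen_patch i)
  indexAt x := (exists_mem_image_patch x).choose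
  mem_baseSet_at x := (exists_mem_image_patch x).choose_spec
  coordChange i k x v :=
    ((patchLabel g A B k (liftPoint x))⁻¹ * patchLabel g A B i (liftPoint x)) v
  coordChange_self i x _ v := by simp
  continuousOn_coordChange i k := by
    rintro ⟨x, v⟩ ⟨⟨hi, hk⟩, -⟩
    let T : ClosedSurface g → Equiv.Perm Y := fun x =>
      (patchLabel g A B k (liftPoint x))⁻¹ * patchLabel g A B i (liftPoint x)
    have hT : ∀ z ∈ patch g i, z ∈ patch g k → T (surfaceProj g z) =
        (patchLabel g A B k z)⁻¹ * patchLabel g A B i z := fun z hi hk =>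
      (patchLabel_inv_mul_eq hAB (surfaceProj_liftPoint _).symm hi hk).symm
    have hopen : IsOpen {x' | (x' ∈ surfaceProj g '' patch g i ∧ x' ∈ surfaceProj g '' patch g k) ∧
        T x' = T x} := by
      rw [← (isQuotientMap_surfaceProj g).isOpen_preimage, isOpen_iff_mem_nhds]
      rintro z ⟨⟨hi, hk⟩, hz⟩
      rw [mem_surfaceProj_image (SidePairing.mem_patch_iff _)] at hi hk
      filter_upwards [(isOpen_patch i).mem_nhds hi, (isOpen_patch k).mem_nhds hk,
        eventually_patchLabel_eq (A := A) (B := B) i hi,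
        eventually_patchLabel_eq (A := A) (B := B) k hk] with w h1 h2 h3 h4
      refine ⟨⟨⟨w, h1, rfl⟩, ⟨w, h2, rfl⟩⟩, ?_⟩
      rw [← hz, hT w h1 h2, hT z hi hk, h3, h4]
    refine ContinuousAt.continuousWithinAt ?_
    have h1 : ∀ᶠ q : ClosedSurface g × Y in 𝓝 (x, v), T q.1 q.2 = T x v := by
      have h2 : ∀ᶠ y in 𝓝 v, y = v := by rw [nhds_discrete]; rfl
      filter_upwards [prod_mem_nhds (hopen.mem_nhds ⟨⟨hi, hk⟩, rfl⟩) h2] with q hq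
      have hq2 : q.2 = v := hq.2
      rw [hq.1.2, hq2]
    exact (continuousAt_const (y := T x v)).congr (h1.mono fun q hq => hq.symm)
  coordChange_comp i j k x _ v := by simp

/-- The lift of the polygon to the covering that has coordinate `y` at the centre. -/
noncomputable def polygonLift (hAB : handleProd A B g = 1) (y : Y) (z : PolygonDisc) :
    TotalSpace Y (coveringCore hAB).Fiber :=
  ⟨surfaceProj g z,
    (patchLabel g A B ((coveringCore hAB).indexAt (surfaceProj g z)) z)⁻¹ y⟩

lemma mem_patch_indexAt (hAB : handleProd A B g = 1) (z : PolygonDisc) :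
    z ∈ patch g ((coveringCore hAB).indexAt (surfaceProj g z)) :=
  (mem_surfaceProj_image (SidePairing.mem_patch_iff _)).1
    ((coveringCore hAB).mem_baseSet_at (surfaceProj g z))

/-- In a fixed chart `i` the fibre coordinate is the inverse of the `i`-th label applied to `y`,
which is locally constant. -/
lemma continuous_polygonLift (hAB : handleProd A B g = 1) (y : Y) :
    Continuous (polygonLift hAB y) := by
  rw [continuous_iff_continuousAt]
  intro z
  rw [FiberBundle.continuousAt_totalSpace]
  refine ⟨(surfaceProj g).continuous.continuousAt, ?_⟩
  let i := (coveringCore hAB).indexAt (surfaceProj g z)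
  have hi : z ∈ patch g i := mem_patch_indexAt hAB z
  refine ContinuousAt.congr (f := fun _ => (patchLabel g A B i z)⁻¹ y) continuousAt_const ?_
  filter_upwards [(isOpen_patch i).mem_nhds hi,
    eventually_patchLabel_eq (A := A) (B := B) i hi] with w h1 h2
  change _ = ((patchLabel g A B i (liftPoint (surfaceProj g w)))⁻¹ *
    patchLabel g A B ((coveringCore hAB).indexAt (surfaceProj g w))
      (liftPoint (surfaceProj g w))) ((patchLabel g A B _ w)⁻¹ y)
  rw [patchLabel_inv_mul_eq hAB (surfaceProj_liftPoint (surfaceProj g w)).symm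
    (mem_patch_indexAt hAB w) h1 |>.symm, h2]
  simp

lemma polygonLift_a (hAB : handleProd A B g = 1) (j : Fin g) {t : ℝ} (ht : t ∈ Set.Icc (0 : ℝ) 1)
    (y : Y) : polygonLift hAB y (boundaryPoint g (4 * (j : ℕ) + t)) =
      polygonLift hAB (A j y) (boundaryPoint g (4 * (j : ℕ) + 3 - t)) := by
  have h := (SidePairing.a j t ht).surfaceProj_eq
  have hi := mem_patch_indexAt hAB (boundaryPoint g (4 * (j : ℕ) + t))
  rw [polygonLift, polygonLift, ← h, patchLabel_a hAB _ j ht hi]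
  simp

lemma polygonLift_b (hAB : handleProd A B g = 1) (j : Fin g) {t : ℝ} (ht : t ∈ Set.Icc (0 : ℝ) 1)
    (y : Y) : polygonLift hAB y (boundaryPoint g (4 * (j : ℕ) + 1 + t)) =
      polygonLift hAB (B j y) (boundaryPoint g (4 * (j : ℕ) + 4 - t)) := by
  have h := (SidePairing.b j t ht).surfaceProj_eq
  have hi := mem_patch_indexAt hAB (boundaryPoint g (4 * (j : ℕ) + 1 + t))
  rw [polygonLift, polygonLift, ← h, patchLabel_b hAB _ j ht hi]
  simp

lemma isCoveringMap_coveringCore (hAB : handleProd A B g = 1) :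
    IsCoveringMap (π Y (coveringCore hAB).Fiber) := FiberBundle.isCoveringMap

/-- The spoke is the image of a path in the polygon, and `polygonLift` lifts that path to the
covering. -/
lemma monodromy_spoke (hAB : handleProd A B g = 1) (y : Y) (z : PolygonDisc) {x : ClosedSurface g}
    (h : surfaceProj g z = x) :
    (isCoveringMap_coveringCore hAB).monodromy (spoke (surfaceProj g) centre z h)
      ⟨polygonLift hAB y centre, rfl⟩ = ⟨polygonLift hAB y z, h⟩ := by
  subst h
  let f : C(PolygonDisc, TotalSpace Y (coveringCore hAB).Fiber) :=
    ⟨polygonLift hAB y, continuous_polygonLift hAB y⟩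
  refine (isCoveringMap_coveringCore hAB).monodromy_eq_of_map_eq
    ((Path.Homotopic.Quotient.mk (PathConnectedSpace.somePath centre z)).map f) ?_
  rw [← Path.Homotopic.Quotient.map_comp]
  rfl

/-- The lifted loop goes out on the sheet of `y` and returns on the sheet of `y'`, which meet above
the identified points. -/
lemma monodromy_jump (hAB : handleProd A B g = 1) {y y' : Y} {z w : PolygonDisc}
    (h : surfaceProj g z = surfaceProj g w) (hzw : polygonLift hAB y z = polygonLift hAB y' w) :
    (isCoveringMap_coveringCore hAB).monodromy (jump (surfaceProj g) centre z w h)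
      ⟨polygonLift hAB y centre, rfl⟩ = ⟨polygonLift hAB y' centre, rfl⟩ := by
  have h1 := monodromy_spoke hAB y z h
  have h2 := monodromy_spoke hAB y' w rfl
  have h3 := (isCoveringMap_coveringCore hAB).monodromy_trans_apply
    (spoke (surfaceProj g) centre w rfl) (spoke (surfaceProj g) centre w rfl).symm
    ⟨polygonLift hAB y' centre, rfl⟩
  rw [Path.Homotopic.Quotient.trans_symm, IsCoveringMap.monodromy_refl, h2] at h3
  change (isCoveringMap_coveringCore hAB).monodromy ((spoke (surfaceProj g) centre z h).trans
    (spoke (surfaceProj g) centre w rfl).symm) _ = _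
  rw [IsCoveringMap.monodromy_trans_apply, h1]
  simp only [hzw]
  exact h3.symm

/-- The fibre over the centre. -/
noncomputable def fibreEquiv (hAB : handleProd A B g = 1) :
    Y ≃ (π Y (coveringCore hAB).Fiber) ⁻¹' {surfaceProj g centre} :=
  Equiv.ofBijective (fun y => ⟨polygonLift hAB y centre, rfl⟩) (by
    constructor
    · intro y y' h
      have := congrArg Subtype.val h
      simp only [polygonLift] at this
      injection this with _ this
      exact Equiv.injective _ this
    · rintro ⟨⟨x, v⟩, hx⟩
      obtain rfl : x = _ := hx
      refine ⟨patchLabel g A B ((coveringCore hAB).indexAt (surfaceProj g centre)) centre v, ?_⟩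
      exact Subtype.ext (congrArg (TotalSpace.mk _) (Equiv.symm_apply_apply _ v)))

lemma fibreEquiv_apply (hAB : handleProd A B g = 1) (y : Y) :
    fibreEquiv hAB y = ⟨polygonLift hAB y centre, rfl⟩ := rfl

/-- The permutation representation of the fundamental group given by the monodromy. -/
noncomputable def monodromyHom (hAB : handleProd A B g = 1) :
    FundamentalGroup (ClosedSurface g) (surfaceProj g centre) →* Equiv.Perm Y :=
  ((fibreEquiv hAB).symm.permCongrHom : _ →* Equiv.Perm Y).comp
    ((isCoveringMap_coveringCore hAB).monodromyPerm (surfaceProj g centre))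

lemma monodromyHom_jump (hAB : handleProd A B g = 1) {z w : PolygonDisc}
    (h : surfaceProj g z = surfaceProj g w) {c : Equiv.Perm Y}
    (hc : ∀ y, polygonLift hAB y z = polygonLift hAB (c y) w) :
    monodromyHom hAB (jump (surfaceProj g) centre z w h) = c := by
  ext1 y
  change (fibreEquiv hAB).symm ((isCoveringMap_coveringCore hAB).monodromy
    (jump (surfaceProj g) centre z w h) (fibreEquiv hAB y)) = c y
  rw [Equiv.symm_apply_eq, fibreEquiv_apply, fibreEquiv_apply, monodromy_jump hAB h (hc y)]

lemma monodromyHom_loopA (hAB : handleProd A B g = 1) {j : ℕ} (hj : j < g) :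
    monodromyHom hAB (loopA g j) = A j := by
  rw [loopA_eq hj (s := 4 * j) (by simp)]
  refine monodromyHom_jump hAB _ fun y => ?_
  have := polygonLift_a hAB ⟨j, hj⟩ (t := 0) (by simp) y
  rw [polar_one, polar_one]
  convert this using 3
  · ring
  · push_cast; ring

lemma monodromyHom_loopB (hAB : handleProd A B g = 1) {j : ℕ} (hj : j < g) :
    monodromyHom hAB (loopB g j) = B j := by
  rw [loopB_eq hj (s := 4 * j + 1) ⟨le_rfl, by linarith⟩]
  refine monodromyHom_jump hAB _ fun y => ?_
  have := polygonLift_b hAB ⟨j, hj⟩ (t := 0) (by simp) y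
  rw [polar_one, polar_one]
  convert this using 3
  · ring
  · push_cast; ring

end Monodromy

/-! ### The main theorem -/

/-- A homeomorphism induces an isomorphism of fundamental groups. -/
noncomputable def Homeomorph.fundamentalGroupMulEquiv {X Z : Type*} [TopologicalSpace X]
    [TopologicalSpace Z] (e : X ≃ₜ Z) (x : X) : FundamentalGroup X x ≃* FundamentalGroup Z (e x) :=
  MulEquiv.ofBijective (FundamentalGroup.map (e : C(X, Z)) x) (by
    constructor
    · intro γ γ' h
      have key : ∀ γ : Path.Homotopic.Quotient x x,
          ((γ.map (e : C(X, Z))).map (e.symm : C(Z, X))).cast (e.symm_apply_apply x).symm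
            (e.symm_apply_apply x).symm = γ := by
        intro γ
        induction γ using Path.Homotopic.Quotient.ind with | mk f =>
        exact congrArg Path.Homotopic.Quotient.mk (Path.ext (funext fun t =>
          e.symm_apply_apply (f t)))
      have h' : Path.Homotopic.Quotient.map γ (e : C(X, Z)) =
        Path.Homotopic.Quotient.map γ' (e : C(X, Z)) := h
      rw [← key γ, ← key γ', h']
    · intro γ
      induction γ using Path.Homotopic.Quotient.ind with | mk f =>
      refine ⟨.mk ((f.map e.symm.continuous).cast (e.symm_apply_apply x).symm
        (e.symm_apply_apply x).symm), ?_⟩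
      exact congrArg Path.Homotopic.Quotient.mk (Path.ext (funext fun t =>
          e.apply_symm_apply (f t))))

instance ClosedSurface.instPathConnectedSpace (g : ℕ) : PathConnectedSpace (ClosedSurface g) :=
  (isQuotientMap_surfaceProj g).surjective.pathConnectedSpace (surfaceProj g).continuous

theorem theorem1 (g : ℕ) (hg : 2 ≤ g) {X : Type*} [TopologicalSpace X]
    (e : X ≃ₜ ClosedSurface g) (x : X) :
    (∃ G : Subgroup (Equiv.Perm ℤ),
      Dense (G : Set (Equiv.Perm ℤ)) ∧ Nonempty (G ≃* FundamentalGroup X x)) ∧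
    (∃ (Y : Type) (_ : Countable Y) (_ : Infinite Y) (_ : MulAction (FundamentalGroup X x) Y),
      FaithfulSMul (FundamentalGroup X x) Y ∧ IsHighlyTransitive (FundamentalGroup X x) Y) := by
  obtain ⟨n, rfl⟩ : ∃ n, g = n + 2 := ⟨g - 2, by omega⟩
  obtain ⟨Y, _, _, θ, hθ, htrans⟩ := exists_faithful_highlyTransitive_surface n
    (loopA (n + 2)) (loopB (n + 2)) (handleProd_loops (n + 2)) (closure_loops (n + 2))
    (fun Y A B hAB => by
      let _ : TopologicalSpace Y := ⊥
      have : DiscreteTopology Y := ⟨rfl⟩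
      exact ⟨monodromyHom hAB, fun i hi =>
        ⟨monodromyHom_loopA hAB hi, monodromyHom_loopB hAB hi⟩⟩)
  let E : FundamentalGroup X x ≃* FundamentalGroup (ClosedSurface (n + 2))
      (surfaceProj (n + 2) centre) :=
    (e.fundamentalGroupMulEquiv x).trans
      (FundamentalGroup.fundamentalGroupMulEquivOfPathConnected _ _)
  refine dense_subgroup_and_action_of_hom (θ.comp E.toMonoidHom) (hθ.comp E.injective)
    fun k u v hu hv => ?_
  obtain ⟨γ, hγ⟩ := htrans k u v hu hv
  refine ⟨E.symm γ, fun i => ?_⟩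
  have : (θ.comp E.toMonoidHom) (E.symm γ) = θ γ := congrArg θ (E.apply_symm_apply γ)
  rw [this, hγ]
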